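/- All graphs are finite and simple. For an integer $k\ge 3$, a \emph{$k$-wheel} is a graph obtained from a cycle of length $k$ by adding a new vertex adjacent to all vertices of the cycle; a \emph{wheel} is a $k$-wheel for some $k\ge 3$. The width of a tree-decomposition is the maximum size of its bags minus one, and the tree-width of a graph is the minimum width of its tree-decompositions. For $S\subseteq V(G)$, an \emph{$S$-rooted tree-decomposition} of $G$ is a tree-decomposition of $G$ whose tree has a specified root such that the bag at the root is equal to $S$. For a graph $H$, let $f(H)$ denote the smallest integer (if it exists) such that every graph of tree-width at least $f(H)$ contains $H$ as a minor. (1) Let $H$ be a wheel. Then every graph of tree-width at least $\max\{\tfrac32|V(H)|-\tfrac92,\ |V(H)|-1\}$ contains $H$ as a minor. In other words, $f(H)$ exists and $f(H)\le\max\{\tfrac32|V(H)|-\tfrac92,\ |V(H)|-1\}$; and if $|V(H)|\le 7$, then $f(H)=|V(H)|-1$. (2) Let $k\ge 3$ be an integer, let $G$ be a graph that does not contain a $k$-wheel as a minor, and let $C$ be either an edge of $G$ (with its two ends) or a cycle in $G$ with $|V(C)|\le k-1$. Then $G$ has a $V(C)$-rooted tree-decomposition all of whose bags have size at most $\max\{\tfrac32k-3,\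 k\}$. -/

import Mathlib

universe u v

namespace SimpleGraph

/-- `H` is a minor of `G`: there are pairwise disjoint, nonempty, connected vertex sets of `G`
(branch sets), one for each vertex of `H`, such that adjacent vertices of `H` have branch sets
joined by an edge of `G`. For finite graphs this says that a graph isomorphic to `H` arises from
`G` by vertex deletions, edge deletions and edge contractions. (`Connected` includes nonempty.) -/
def IsMinorOf {W V : Type*} (H : SimpleGraph W) (G : SimpleGraph V) : Prop :=
  ∃ B : W → Set V,
    (∀ w, (G.induce (B w)).Connected) ∧
    (∀ w w', w ≠ w' → Disjoint (B w) (B w')) ∧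
    (∀ w w', H.Adj w w' → ∃ x ∈ B w, ∃ y ∈ B w', G.Adj x y)

/-- The graph `F⁺` obtained from `F` by adding a new vertex (the apex `none`) adjacent to every
vertex of `F`. -/
def addApex {V : Type*} (F : SimpleGraph V) : SimpleGraph (Option V) where
  Adj
    | none, none => False
    | none, some _ => True
    | some _, none => True
    | some x, some y => F.Adj x y
  symm := ⟨by
    rintro (_ | x) (_ | y) h
    · exact h
    · trivial
    · trivial
    · exact F.adj_symm h⟩
  loopless := ⟨by
    rintro (_ | x) h
    · exact h
    · exact F.irrefl h⟩

/-- The `k`-wheel, for `k ≥ 3`: a cycle of length `k` together with an apex. -/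
def wheelGraph (k : ℕ) : SimpleGraph (Option (Fin k)) :=
  (cycleGraph k).addApex

/-- `H` is a wheel, i.e. (isomorphic to) the `k`-wheel for some `k ≥ 3`. -/
def IsWheel {W : Type*} (H : SimpleGraph W) : Prop :=
  ∃ k : ℕ, 3 ≤ k ∧ Nonempty (H ≃g wheelGraph k)

/-- A tree-decomposition of `G`, indexed by the nodes of a finite tree. -/
structure TreeDecomposition {V : Type*} (G : SimpleGraph V) where
  /-- the nodes of the tree -/
  Node : Type
  /-- there are finitely many nodes -/
  [fintypeNode : Fintype Node]
  /-- the tree -/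
  tree : SimpleGraph Node
  isTree : tree.IsTree
  /-- the bag at each node -/
  bag : Node → Finset V
  exists_mem_bag : ∀ v : V, ∃ t, v ∈ bag t
  exists_adj_bag : ∀ u v : V, G.Adj u v → ∃ t, u ∈ bag t ∧ v ∈ bag t
  connected_bags : ∀ v : V, (tree.induce {t | v ∈ bag t}).Connected

attribute [instance] TreeDecomposition.fintypeNode

/-- The width of a tree-decomposition: the maximum size of a bag, minus one. -/
def TreeDecomposition.width {V : Type*} {G : SimpleGraph V} (D : G.TreeDecomposition) : ℤ :=
  ((Finset.univ.sup fun t => (D.bag t).card : ℕ) : ℤ) - 1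

/-- The tree-width of a finite graph: the minimum width of a tree-decomposition. (The set of
widths is bounded below by `-1`, and it is nonempty because the graph is finite, so the infimum
in `ℤ` is attained.) -/
noncomputable def treeWidth {V : Type*} (G : SimpleGraph V) : ℤ :=
  sInf {w : ℤ | ∃ D : G.TreeDecomposition, D.width = w}

/-- A rooted tree-decomposition: a tree-decomposition with a specified node, the root. -/
structure RootedTreeDecomposition {V : Type*} (G : SimpleGraph V) extends
    TreeDecomposition G where
  /-- the root of the tree -/
  root : Node

/-- A rooted tree-decomposition is `S`-rooted if its root bag equals `S`. -/
def RootedTreeDecomposition.IsRootedAt {V : Type*} {G : SimpleGraph V}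
    (D : G.RootedTreeDecomposition) (S : Set V) : Prop :=
  (D.bag D.root : Set V) = S

/-- The subgraph `C` of `G` consists of a single edge of `G` and its two ends. -/
def Subgraph.IsSingleEdge {V : Type*} {G : SimpleGraph V} (C : G.Subgraph) : Prop :=
  ∃ (u v : V) (h : G.Adj u v), C = G.subgraphOfAdj h

/-- The subgraph `C` of `G` is a cycle of `G`. -/
def Subgraph.IsCycleSubgraph {V : Type*} {G : SimpleGraph V} (C : G.Subgraph) : Prop :=
  ∃ (u : V) (p : G.Walk u u), p.IsCycle ∧ C = p.toSubgraph

/-- Every finite graph of tree-width at least `n` contains `H` as a minor. -/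
def TreeWidthForcesMinor {W : Type v} (H : SimpleGraph W) (n : ℤ) : Prop :=
  ∀ (V : Type u) [Finite V] (G : SimpleGraph V), n ≤ G.treeWidth → H.IsMinorOf G

/-- `f` is the smallest integer such that every finite graph of tree-width at least `f` contains
`H` as a minor; this integer is the value `f(H)`. -/
def IsGridMinorValue {W : Type v} (H : SimpleGraph W) (f : ℤ) : Prop :=
  IsLeast {n : ℤ | TreeWidthForcesMinor.{u, v} H n} f

end SimpleGraph

/-! Call a set E ringed if its outer boundary has a cyclic order realised outside E: disjoint
connected sets, one around each boundary vertex, are joined by edges in that order. If E is also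
connected, contracting E to a hub and the ring to a rim shows that without a k-wheel minor the
boundary has fewer than k vertices (`Ringed.ncard_bdry_lt`). The decomposition is a recursion over
connected ringed sets: `exists_separator` finds a nonempty Y ⊆ E such that bdry E ∪ Y fits in a bag
and every component of E \ Y is again ringed. It starts from the components left after deleting an
edge, a cycle or nothing; the deleted vertices, as singletons, form the first necklace.

One vertex suffices for Y if the ring has at most one member, or if some x ∈ E is such that no
connected subset of E \ {x} sees all of bdry E. Such bags have size at most k. Otherwise take a
maximal connected D ⊆ E for which some connected subset of E \ D sees two consecutive ring members.
By maximality every such subset contains all attachments of D in E, and Y is the set of these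
attachments. They lie on one path through E \ D, which completes a ring around D (`ringed_core`); so
D has at most k - 1 boundary vertices. The components of E \ Y other than D are treated in
`ringed_rest`.

Two consecutive ring members that both have neighbours in E \ D are both seen by D
(`mem_bdry_core`). Hence the ring members unseen by D are sparse: there are none, or at most (k -
4)/2 (`ncard_bdry_diff_le`). The bag bdry E ∪ Y then has size at most (k - 1) + (k - 4)/2 = 3k/2 -
3, or at most k - 1 if there are none.

For the lower bound on f, the complete graph on k vertices has tree-width at least k - 1 but too few
vertices for a k-wheel minor. -/

namespace SimpleGraph

variable {V : Type*} {G : SimpleGraph V}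

/-! ### Connected sets, boundaries and components -/

/-- The set `U` induces a connected (in particular nonempty) subgraph of `G`. -/
abbrev Conn (G : SimpleGraph V) (U : Set V) : Prop := (G.induce U).Connected

/-- The outer vertex boundary of `E`. -/
def bdry (G : SimpleGraph V) (E : Set V) : Set V := {v | v ∉ E ∧ ∃ e ∈ E, G.Adj e v}

/-- The sets `A` and `B` intersect or are joined by an edge. -/
def Touch (G : SimpleGraph V) (A B : Set V) : Prop := ∃ a ∈ A, ∃ b ∈ B, a = b ∨ G.Adj a b

lemma Touch.symm {A B : Set V} (h : G.Touch A B) : G.Touch B A := by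
  obtain ⟨a, ha, b, hb, h⟩ := h
  exact ⟨b, hb, a, ha, h.imp Eq.symm G.adj_symm⟩

lemma Touch.mono {A A' B B' : Set V} (h : G.Touch A B) (hA : A ⊆ A') (hB : B ⊆ B') :
    G.Touch A' B' := by
  obtain ⟨a, ha, b, hb, h⟩ := h
  exact ⟨a, hA ha, b, hB hb, h⟩

lemma touch_of_mem_bdry {A B : Set V} {v : V} (h : v ∈ G.bdry A) (hv : v ∈ B) : G.Touch A B := by
  obtain ⟨_, e, he, hadj⟩ := h
  exact ⟨e, he, v, hv, Or.inr hadj⟩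

lemma Conn.nonempty {U : Set V} (h : G.Conn U) : U.Nonempty := by
  obtain ⟨x⟩ := SimpleGraph.Connected.nonempty h
  exact ⟨x.1, x.2⟩

lemma conn_singleton (x : V) : G.Conn {x} := by
  rw [Conn, connected_iff]
  refine ⟨?_, ⟨⟨x, rfl⟩⟩⟩
  rintro ⟨a, rfl⟩ ⟨b, rfl⟩
  exact Reachable.refl _

lemma Conn.union {A B : Set V} (hA : G.Conn A) (hB : G.Conn B) (h : G.Touch A B) :
    G.Conn (A ∪ B) := by
  obtain ⟨a, ha, b, hb, rfl | h⟩ := h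
  · exact induce_union_connected hA.preconnected hB.preconnected ⟨a, ha, hb⟩
  · exact connected_induce_union hA.preconnected hB.preconnected ha hb h

/-- A connected set has an edge across each of its nontrivial partitions. -/
lemma Conn.exists_adj {E A : Set V} (hE : G.Conn E) (hA : A ⊆ E) (hne : A.Nonempty)
    (hne' : (E \ A).Nonempty) : ∃ a ∈ A, ∃ b ∈ E \ A, G.Adj a b := by
  obtain ⟨a, ha⟩ := hne
  obtain ⟨b, hb, hbA⟩ := hne'
  obtain ⟨p⟩ := hE.preconnected ⟨a, hA ha⟩ ⟨b, hb⟩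
  obtain ⟨d, -, h1, h2⟩ := p.exists_boundary_dart {x | x.1 ∈ A} ha hbA
  exact ⟨d.fst.1, h1, d.snd.1, ⟨d.snd.2, h2⟩, d.adj⟩

/-- The component of `u` in the subgraph induced by `U`. -/
def compIn (G : SimpleGraph V) (U : Set V) (u : V) : Set V :=
  {v | ∃ (hu : u ∈ U) (hv : v ∈ U), (G.induce U).Reachable ⟨u, hu⟩ ⟨v, hv⟩}

lemma compIn_subset (U : Set V) (u : V) : G.compIn U u ⊆ U := fun _ ⟨_, hv, _⟩ => hv

lemma self_mem_compIn {U : Set V} {u : V} (hu : u ∈ U) : u ∈ G.compIn U u :=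
  ⟨hu, hu, Reachable.refl _⟩

lemma mem_compIn_of_adj {U : Set V} {u v w : V} (hv : v ∈ G.compIn U u) (hw : w ∈ U)
    (h : G.Adj v w) : w ∈ G.compIn U u := by
  obtain ⟨hu, hv, hr⟩ := hv
  exact ⟨hu, hw, hr.trans (Adj.reachable (by simpa using h))⟩

lemma conn_compIn {U : Set V} {u : V} (hu : u ∈ U) : G.Conn (G.compIn U u) := by
  apply G.induce_connected_of_patches u (self_mem_compIn hu)
  rintro v ⟨_, hv, ⟨p⟩⟩
  classical
  let q := p.map (Embedding.induce U).toHom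
  refine ⟨{x | x ∈ q.support}, ?_, q.start_mem_support, q.end_mem_support,
    (q.connected_induce_support).preconnected _ _⟩
  intro x hx
  have hx : x ∈ q.support := hx
  rw [Walk.support_map, List.mem_map] at hx
  obtain ⟨y, hy, rfl⟩ := hx
  exact ⟨hu, y.2, ⟨p.takeUntil y hy⟩⟩

lemma bdry_compIn_disjoint (U : Set V) (u : V) : Disjoint (G.bdry (G.compIn U u)) U := by
  rw [Set.disjoint_left]
  rintro v ⟨hv, e, he, hadj⟩ hvU
  exact hv (mem_compIn_of_adj he hvU hadj)

/-- A connected subset `K` of `E` meeting `F`, and disjoint from the boundary of `F`, lies in `F`. -/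
lemma Conn.subset_of_disjoint_bdry {K F : Set V} (hK : G.Conn K) (hne : (K ∩ F).Nonempty)
    (h : Disjoint K (G.bdry F)) : K ⊆ F := by
  by_contra hcon
  rw [Set.not_subset] at hcon
  obtain ⟨w, hw, hwF⟩ := hcon
  obtain ⟨a, ha, b, hb, hab⟩ := hK.exists_adj (A := K ∩ F) Set.inter_subset_left hne
    ⟨w, hw, fun h => hwF h.2⟩
  exact Set.disjoint_left.1 h hb.1 ⟨fun h => hb.2 ⟨hb.1, h⟩, a, ha.2, hab⟩

/-- Removing `F` from a connected set `E` leaves a connected set, when all attachments of `F` in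
`E` lie in a common connected subset. -/
lemma Conn.diff {E F Q : Set V} (hE : G.Conn E) (hQ : G.Conn Q) (hQE : Q ⊆ E \ F)
    (h : G.bdry F ∩ E ⊆ Q) : G.Conn (E \ F) := by
  obtain ⟨q, hq⟩ := hQ.nonempty
  have hW := conn_compIn (G := G) (hQE hq)
  have hQW : Q ⊆ G.compIn (E \ F) q :=
    hQ.subset_of_disjoint_bdry ⟨q, hq, self_mem_compIn (hQE hq)⟩
      ((bdry_compIn_disjoint _ _).symm.mono_left hQE)
  suffices h : G.compIn (E \ F) q = E \ F by rwa [← h]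
  refine (compIn_subset _ _).antisymm ?_
  by_contra hcon
  rw [Set.not_subset] at hcon
  obtain ⟨w, hw, hwW⟩ := hcon
  -- An edge of E leaving the uncovered part would end in F, making its first end an attachment in
  -- Q, or in the component itself.
  obtain ⟨a, ha, b, hb, hab⟩ := hE.exists_adj (A := (E \ F) \ G.compIn (E \ F) q)
    (fun x hx => hx.1.1) ⟨w, hw, hwW⟩ ⟨q, (hQE hq).1, fun h => h.2 (self_mem_compIn (hQE hq))⟩
  by_cases hbF : b ∈ F
  · exact ha.2 (hQW (h ⟨⟨ha.1.2, b, hbF, hab.symm⟩, ha.1.1⟩))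
  · have hbW : b ∈ G.compIn (E \ F) q := by
      by_contra hbW
      exact hb.2 ⟨⟨hb.1, hbF⟩, hbW⟩
    exact ha.2 (mem_compIn_of_adj hbW ha.1 hab.symm)

lemma conn_of_isChain {p : List V} (h : List.IsChain G.Adj p) (hp : p ≠ []) :
    G.Conn {v | v ∈ p} := by
  induction p with
  | nil => exact absurd rfl hp
  | cons a l ih =>
    rcases l with _ | ⟨b, l⟩
    · simpa using conn_singleton a
    · rw [List.isChain_cons_cons] at h
      have := (conn_singleton (G := G) a).union (ih h.2 (by simp))
        ⟨a, rfl, b, by simp, Or.inr h.1⟩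
      convert this using 2
      ext v; simp

lemma Conn.exists_path {U : Set V} (hU : G.Conn U) {x y : V} (hx : x ∈ U) (hy : y ∈ U) :
    ∃ p : List V, p.Nodup ∧ p.IsChain G.Adj ∧ p.head? = some x ∧ p.getLast? = some y ∧
      ∀ v ∈ p, v ∈ U := by
  classical
  obtain ⟨w⟩ := hU.preconnected ⟨x, hx⟩ ⟨y, hy⟩
  let q := w.toPath.1.map (Embedding.induce U).toHom
  have hq : q.IsPath := Walk.IsPath.map (Embedding.induce (G := G) U).injective
    w.toPath.2
  refine ⟨q.support, hq.support_nodup, q.isChain_adj_support, ?_, ?_, ?_⟩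
  · rw [List.head?_eq_some_head q.support_ne_nil, Walk.head_support]; rfl
  · rw [List.getLast?_eq_some_getLast q.support_ne_nil, Walk.getLast_support]; rfl
  · intro v hv
    rw [Walk.support_map, List.mem_map] at hv
    obtain ⟨y, hy, rfl⟩ := hv
    exact y.2

lemma bdry_subset_of_subset {E F : Set V} (h : F ⊆ E) : G.bdry F ⊆ E ∪ G.bdry E := by
  rintro v ⟨hv, e, he, hadj⟩
  by_cases hvE : v ∈ E
  · exact Or.inl hvE
  · exact Or.inr ⟨hvE, e, h he, hadj⟩

lemma mem_bdry_mono {U W : Set V} (h : U ⊆ W) {t : V} (ht : t ∈ G.bdry U) (htW : t ∉ W) :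
    t ∈ G.bdry W := by
  obtain ⟨_, e, he, hadj⟩ := ht
  exact ⟨htW, e, h he, hadj⟩

lemma isChain_touch_of_forall₂ {L L' : List (Set V)} (h : List.Forall₂ (· ⊆ ·) L L')
    (hL : L.IsChain G.Touch) : L'.IsChain G.Touch := by
  induction h with
  | nil => exact List.isChain_nil
  | cons hab hl ih =>
    cases hl with
    | nil => exact List.isChain_singleton _
    | cons hcd hl =>
      rw [List.isChain_cons_cons] at hL ⊢
      exact ⟨hL.1.mono hab hcd, ih hL.2⟩

/-! ### Necklaces and rings -/

/-- A cyclic sequence of pairwise disjoint connected sets avoiding `E`, in which consecutive sets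
are joined by edges. -/
structure IsNecklace (G : SimpleGraph V) (E : Set V) (L : List (Set V)) : Prop where
  conn : ∀ A ∈ L, G.Conn A
  disjoint_left : ∀ A ∈ L, Disjoint A E
  pairwise : L.Pairwise Disjoint
  chain : Cycle.Chain G.Touch (L : Cycle (Set V))

lemma IsNecklace.rotate {E : Set V} {L L' : List (Set V)} (h : G.IsNecklace E L) (hL : L ~r L') :
    G.IsNecklace E L' where
  conn A hA := h.conn A (hL.mem_iff.2 hA)
  disjoint_left A hA := h.disjoint_left A (hL.mem_iff.2 hA)
  pairwise := (hL.perm.pairwise_iff (fun h => h.symm)).1 h.pairwise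
  chain := by rw [← Cycle.coe_eq_coe.2 hL]; exact h.chain

lemma IsNecklace.merge {E A B : Set V} {L : List (Set V)} (h : G.IsNecklace E (A :: B :: L)) :
    G.IsNecklace E ((A ∪ B) :: L) := by
  have hc := h.chain
  rw [Cycle.chain_coe_cons, List.cons_append, List.isChain_cons_cons] at hc
  have hA := h.conn A (by simp)
  have hB := h.conn B (by simp)
  have hp := h.pairwise
  simp only [List.pairwise_cons, List.mem_cons, forall_eq_or_imp] at hp
  refine ⟨?_, ?_, ?_, ?_⟩
  · rintro X hX
    rcases List.mem_cons.1 hX with rfl | hX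
    · exact hA.union hB hc.1
    · exact h.conn X (by simp [hX])
  · rintro X hX
    rcases List.mem_cons.1 hX with rfl | hX
    · exact Set.disjoint_union_left.2 ⟨h.disjoint_left A (by simp), h.disjoint_left B (by simp)⟩
    · exact h.disjoint_left X (by simp [hX])
  · rw [List.pairwise_cons]
    exact ⟨fun X hX => Set.disjoint_union_left.2 ⟨hp.1.2 X hX, hp.2.1 X hX⟩, hp.2.2⟩
  · rw [Cycle.chain_coe_cons]
    refine isChain_touch_of_forall₂ (L := B :: (L ++ [A])) ?_ hc.2
    refine List.Forall₂.cons Set.subset_union_right ?_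
    have h₁ : List.Forall₂ (fun X Y : Set V => X ⊆ Y) L L := List.forall₂_same.2 fun _ _ => subset_rfl
    have h₂ : List.Forall₂ (fun X Y : Set V => X ⊆ Y) [A] [A ∪ B] :=
      List.Forall₂.cons Set.subset_union_left List.Forall₂.nil
    exact List.rel_append h₁ h₂

/-- `cs` lists the boundary of `E` in a cyclic order that is realised outside `E`: the disjoint
connected sets `B c ∋ c` form a necklace avoiding `E`. -/
structure IsRing (G : SimpleGraph V) (E : Set V) (cs : List V) (B : V → Set V) : Prop where
  nodup : cs.Nodup
  mem_iff : ∀ v, v ∈ cs ↔ v ∈ G.bdry E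
  mem_self : ∀ c ∈ cs, c ∈ B c
  necklace : G.IsNecklace E (cs.map B)

/-- The boundary of `E` has a cyclic order that is realised outside `E`. -/
def Ringed (G : SimpleGraph V) (E : Set V) : Prop := ∃ cs B, G.IsRing E cs B

/-- Members without a boundary vertex are merged into the next member until each carries exactly
one. All rings below are produced this way, so their necklaces may contain superfluous members. -/
lemma ringed_of_isNecklace {E : Set V} {L : List (Set V)} (hL : G.IsNecklace E L)
    (hsub : ∀ A ∈ L, (A ∩ G.bdry E).Subsingleton) (hcov : ∀ v ∈ G.bdry E, ∃ A ∈ L, v ∈ A) :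
    G.Ringed E := by
  classical
  induction hn : L.length using Nat.strong_induction_on generalizing L with
  | _ n ih =>
  subst hn
  rcases isEmpty_or_nonempty V with hV | hV
  · exact ⟨[], fun _ => ∅, List.nodup_nil, fun v => isEmptyElim v, by simp,
      ⟨by simp, by simp, by simp, Cycle.Chain.nil _⟩⟩
  by_cases hall : ∀ A ∈ L, (A ∩ G.bdry E).Nonempty
  · choose! f hf using hall
    have hinj : ∀ A ∈ L, ∀ A' ∈ L, f A = f A' → A = A' := by
      intro A hA A' hA' hff
      by_contra hne
      have := hL.pairwise.forall hA hA' hne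
      exact Set.disjoint_left.1 this (hf A hA).1 (hff ▸ (hf A' hA').1)
    have hLnd : L.Nodup := by
      refine hL.pairwise.imp_of_mem ?_
      rintro A A' hA _ hd rfl
      exact Set.disjoint_left.1 hd (hf A hA).1 (hf A hA).1
    let B : V → Set V := fun v => if h : ∃ A ∈ L, f A = v then h.choose else ∅
    have hB : ∀ A ∈ L, B (f A) = A := by
      intro A hA
      have h : ∃ A' ∈ L, f A' = f A := ⟨A, hA, rfl⟩
      simp only [B, dif_pos h]
      exact hinj _ h.choose_spec.1 _ hA h.choose_spec.2
    have hmap : (L.map f).map B = L := by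
      rw [List.map_map]
      conv_rhs => rw [← List.map_id L]
      exact List.map_congr_left fun A hA => hB A hA
    refine ⟨L.map f, B, ?_, ?_, ?_, ?_⟩
    · exact List.Nodup.map_on hinj hLnd
    · intro v
      rw [List.mem_map]
      constructor
      · rintro ⟨A, hA, rfl⟩; exact (hf A hA).2
      · intro hv
        obtain ⟨A, hA, hvA⟩ := hcov v hv
        exact ⟨A, hA, hsub A hA (hf A hA) ⟨hvA, hv⟩⟩
    · intro c hc
      obtain ⟨A, hA, rfl⟩ := List.mem_map.1 hc
      rw [hB A hA]; exact (hf A hA).1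
    · rwa [hmap]
  · push Not at hall
    obtain ⟨A, hA, hAe⟩ := hall
    obtain ⟨l₁, l₂, rfl⟩ := List.append_of_mem hA
    have hrot : l₁ ++ A :: l₂ ~r A :: (l₂ ++ l₁) := by
      simpa using List.isRotated_append (l := l₁) (l' := A :: l₂)
    have hN := hL.rotate hrot
    have hmem : ∀ X, X ∈ l₁ ++ A :: l₂ ↔ X ∈ A :: (l₂ ++ l₁) := fun X => hrot.mem_iff
    have hlen : (l₁ ++ A :: l₂).length = (l₂ ++ l₁).length + 1 := by simp; omega
    simp only [hmem] at hsub hcov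
    rcases hl : l₂ ++ l₁ with _ | ⟨A', l⟩
    -- A sole member without a boundary vertex forces the boundary to be empty.
    · rw [hl] at hcov
      refine ⟨[], fun _ => ∅, List.nodup_nil, ?_, by simp, ⟨by simp, by simp, by simp, ?_⟩⟩
      · intro v
        simp only [List.not_mem_nil, false_iff]
        intro hv
        obtain ⟨X, hX, hvX⟩ := hcov v hv
        rw [List.mem_singleton] at hX
        subst hX
        exact (Set.eq_empty_iff_forall_notMem.1 hAe v) ⟨hvX, hv⟩
      · exact Cycle.Chain.nil _
    · rw [hl] at hcov hN hsub hlen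
      refine ih _ ?_ hN.merge ?_ ?_ rfl
      · rw [hlen]; simp
      · intro X hX
        rcases List.mem_cons.1 hX with rfl | hX
        · rw [Set.union_inter_distrib_right, hAe, Set.empty_union]
          exact hsub A' (by simp)
        · exact hsub X (by simp [hX])
      · intro v hv
        obtain ⟨X, hX, hvX⟩ := hcov v hv
        simp only [List.mem_cons] at hX
        rcases hX with rfl | rfl | hX
        · exact ⟨_, List.mem_cons_self, Or.inl hvX⟩
        · exact ⟨_, List.mem_cons_self, Or.inr hvX⟩
        · exact ⟨X, List.mem_cons_of_mem _ hX, hvX⟩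

/-! ### Wheel minors from necklaces -/

lemma Touch.exists_adj {A B : Set V} (h : G.Touch A B) (hd : Disjoint A B) :
    ∃ x ∈ A, ∃ y ∈ B, G.Adj x y := by
  obtain ⟨a, ha, b, hb, rfl | h⟩ := h
  · exact absurd hb (Set.disjoint_left.1 hd ha)
  · exact ⟨a, ha, b, hb, h⟩

/-- E is the hub and the necklace the rim. Surplus members are merged, and a merged member still
meets the boundary of E. -/
lemma wheelGraph_isMinorOf_of_isNecklace {k : ℕ} (hk : 3 ≤ k) {E : Set V} (hE : G.Conn E)
    {L : List (Set V)} (hL : G.IsNecklace E L) (hs : ∀ A ∈ L, (A ∩ G.bdry E).Nonempty)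
    (hlen : k ≤ L.length) : (wheelGraph k).IsMinorOf G := by
  induction hn : L.length generalizing L with
  | zero => omega
  | succ n ih =>
  by_cases hkn : k ≤ n
  · rcases L with _ | ⟨A, _ | ⟨B, L⟩⟩
    · simp at hn
    · simp at hn; omega
    · refine ih hL.merge ?_ (by simpa using hkn.trans (by simp at hn; omega)) (by simpa using hn)
      intro X hX
      rcases List.mem_cons.1 hX with rfl | hX
      · exact (hs A (by simp)).mono (by gcongr; exact Set.subset_union_left)
      · exact hs X (by simp [hX])
  · have hlk : L.length = k := by omega
    subst hlk
    have hdisj : ∀ i j : Fin L.length, i ≠ j → Disjoint (L.get i) (L.get j) := by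
      intro i j hij
      rcases lt_or_gt_of_ne hij with h | h
      · exact List.pairwise_iff_getElem.1 hL.pairwise _ _ _ _ h
      · exact (List.pairwise_iff_getElem.1 hL.pairwise _ _ _ _ h).symm
    have hstep : ∀ i j : Fin L.length, (j - i).val = 1 → G.Touch (L.get i) (L.get j) := by
      intro i j hij
      obtain ⟨i, hi⟩ := i
      obtain ⟨j, hj⟩ := j
      rw [Fin.sub_def] at hij
      simp only at hij
      have hc := hL.chain
      rcases L with _ | ⟨a, l⟩
      · simp at hi
      rw [Cycle.chain_coe_cons, List.isChain_iff_getElem] at hc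
      have h1 := hc i (by simpa using hi)
      simp only [List.length_cons] at hi hj hij hk
      simp only [List.get_eq_getElem]
      -- A difference of 1 in `Fin` means the next index or the wrap-around; the quotient below
      -- decides which.
      have : (j = i + 1) ∨ (i = l.length ∧ j = 0) := by
        have h2 := Nat.mod_add_div (l.length + 1 - i + j) (l.length + 1)
        rw [hij] at h2
        have h3 : (l.length + 1 - i + j) / (l.length + 1) < 2 := by
          rw [Nat.div_lt_iff_lt_mul (by omega)]; omega
        interval_cases (l.length + 1 - i + j) / (l.length + 1) <;> omega
      have e : ∀ m (hm : m < (a :: l).length),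
          (a :: (l ++ [a]))[m]'(by simp at hm ⊢; omega) = (a :: l)[m] :=
        fun m hm => List.getElem_append_left (as := a :: l) (bs := [a]) hm
      rcases this with rfl | ⟨rfl, rfl⟩
      · rw [e i hi, e (i + 1) hj] at h1
        exact h1
      · rw [e _ hi] at h1
        simpa using h1
    refine ⟨fun o => o.elim E L.get, ?_, ?_, ?_⟩
    · rintro (_ | i)
      · exact hE
      · exact hL.conn _ (List.get_mem _ _)
    · rintro (_ | i) (_ | j) hij
      · exact absurd rfl hij
      · exact (hL.disjoint_left _ (List.get_mem _ _)).symm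
      · exact hL.disjoint_left _ (List.get_mem _ _)
      · exact hdisj i j (fun h => hij (by rw [h]))
    · have hspoke : ∀ i, ∃ x ∈ E, ∃ y ∈ L.get i, G.Adj x y := by
        intro i
        obtain ⟨y, hy, _, e, he, hadj⟩ := hs _ (List.get_mem L i)
        exact ⟨e, he, y, hy, hadj⟩
      rintro (_ | i) (_ | j) hij
      · exact hij.elim
      · exact hspoke j
      · obtain ⟨x, hx, y, hy, h⟩ := hspoke i
        exact ⟨y, hy, x, hx, h.symm⟩
      · have hij : (cycleGraph L.length).Adj i j := hij
        have hne : i ≠ j := hij.ne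
        rw [cycleGraph_adj'] at hij
        refine Touch.exists_adj ?_ (hdisj i j hne)
        rcases hij with h | h
        · exact (hstep j i h).symm
        · exact hstep i j h

lemma IsRing.length_eq {E : Set V} {cs : List V} {B : V → Set V} (h : G.IsRing E cs B) :
    cs.length = (G.bdry E).ncard := by
  classical
  rw [← List.toFinset_card_of_nodup h.nodup, ← Set.ncard_coe_finset]
  congr 1
  ext v
  simp [h.mem_iff]

lemma Ringed.ncard_bdry_lt {k : ℕ} (hk : 3 ≤ k) (hG : ¬ (wheelGraph k).IsMinorOf G) {E : Set V}
    (hE : G.Conn E) (h : G.Ringed E) : (G.bdry E).ncard < k := by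
  by_contra hcon
  obtain ⟨cs, B, h⟩ := h
  refine hG (wheelGraph_isMinorOf_of_isNecklace hk hE h.necklace ?_ ?_)
  · intro A hA
    obtain ⟨c, hc, rfl⟩ := List.mem_map.1 hA
    exact ⟨c, h.mem_self c hc, (h.mem_iff c).1 hc⟩
  · rw [List.length_map, h.length_eq]; omega

/-! ### Gluing tree-decompositions -/

lemma Conn.image {W : Type*} {H : SimpleGraph W} (f : G →g H) {A : Set V} (h : G.Conn A) :
    H.Conn (f '' A) := by
  refine SimpleGraph.Connected.map (induceHom f (Set.mapsTo_image f A)) ?_ h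
  rintro ⟨_, a, ha, rfl⟩
  exact ⟨⟨a, ha⟩, rfl⟩

lemma IsAcyclic.sum {W : Type*} {H : SimpleGraph W} (hG : G.IsAcyclic) (hH : H.IsAcyclic) :
    (G ⊕g H).IsAcyclic := by
  rw [isAcyclic_iff_forall_adj_isBridge] at hG hH ⊢
  -- Walks in a disjoint sum stay in their summand, whichever edges are deleted, so bridges remain
  -- bridges.
  have key : ∀ (s : Set (Sym2 (V ⊕ W))) (x z : V ⊕ W), ((G ⊕g H).deleteEdges s).Reachable x z →
      (∀ v, x = .inl v → ∃ v', z = .inl v' ∧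
        (G.deleteEdges {e | e.map .inl ∈ s}).Reachable v v') ∧
      (∀ w, x = .inr w → ∃ w', z = .inr w' ∧
        (H.deleteEdges {e | e.map .inr ∈ s}).Reachable w w') := by
    intro s x z h
    rw [reachable_iff_reflTransGen] at h
    induction h with
    | refl => exact ⟨fun v hv => ⟨v, hv, Reachable.refl _⟩, fun w hw => ⟨w, hw, Reachable.refl _⟩⟩
    | @tail y z _ hyz ih =>
      constructor
      · intro v hv
        obtain ⟨v', rfl, hr⟩ := ih.1 v hv
        rcases z with z | z
        · exact ⟨z, rfl, hr.trans (Adj.reachable (by simpa using hyz))⟩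
        · simp at hyz
      · intro w hw
        obtain ⟨w', rfl, hr⟩ := ih.2 w hw
        rcases z with z | z
        · simp at hyz
        · exact ⟨z, rfl, hr.trans (Adj.reachable (by simpa using hyz))⟩
  rintro (v | w) (v' | w') hadj
  · have hb := hG (by simpa using hadj)
    intro hr
    obtain ⟨_, hz, hr⟩ := (key _ _ _ hr).1 v rfl
    cases hz
    refine hb (hr.mono ?_)
    intro a b
    simp only [deleteEdges_adj, Set.mem_ofPred_eq, Set.mem_singleton_iff]
    rintro ⟨h1, h2⟩
    exact ⟨h1, fun h => h2 (by rw [h]; rfl)⟩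
  · simp at hadj
  · simp at hadj
  · have hb := hH (by simpa using hadj)
    intro hr
    obtain ⟨_, hz, hr⟩ := (key _ _ _ hr).2 w rfl
    cases hz
    refine hb (hr.mono ?_)
    intro a b
    simp only [deleteEdges_adj, Set.mem_ofPred_eq, Set.mem_singleton_iff]
    rintro ⟨h1, h2⟩
    exact ⟨h1, fun h => h2 (by rw [h]; rfl)⟩

lemma IsTree.sum_sup_edge {W : Type*} {H : SimpleGraph W} (hG : G.IsTree) (hH : H.IsTree)
    (v : V) (w : W) : ((G ⊕g H) ⊔ edge (.inl v) (.inr w)).IsTree :=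
  ⟨hG.1.sum_sup_edge hH.1, (hG.2.sum hH.2).sup_edge_of_not_reachable
    (not_reachable_sum_inl_inr v w)⟩

/-- The subgraph of `G` induced by `U` has a tree-decomposition with bags of size at most `m`
and with a root whose bag is `S`. -/
def HasDecomp (G : SimpleGraph V) (m : ℕ) (U S : Set V) : Prop :=
  ∃ (N : Type) (_ : Fintype N) (T : SimpleGraph N) (r : N) (bag : N → Finset V),
    T.IsTree ∧ (∀ t, (bag t).card ≤ m) ∧ (bag r : Set V) = S ∧ (∀ t, (bag t : Set V) ⊆ U) ∧
    (∀ u ∈ U, ∀ v ∈ U, G.Adj u v → ∃ t, u ∈ bag t ∧ v ∈ bag t) ∧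
    ∀ v ∈ U, T.Conn {t | v ∈ bag t}

lemma hasDecomp_self [Finite V] {m : ℕ} {S : Set V} (hS : S.ncard ≤ m) : G.HasDecomp m S S := by
  classical
  have hfin := S.toFinite
  refine ⟨Unit, inferInstance, ⊥, (), fun _ => hfin.toFinset, IsTree.of_subsingleton, ?_, ?_, ?_,
    ?_, ?_⟩
  · intro _; rwa [← Set.ncard_eq_toFinset_card S hfin]
  · simp
  · simp
  · intro u hu v hv _
    exact ⟨(), by simpa using hu, by simpa using hv⟩
  · intro v hv
    convert conn_singleton (G := (⊥ : SimpleGraph Unit)) ()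
    ext; simp [hv]

/-- The two roots are joined by an edge. Shared vertices lie in both root bags, so their nodes are
connected through it, and `hadj` ensures that each edge of the union lies within one side. -/
lemma HasDecomp.glue {m : ℕ} {U₁ S₁ U₂ S₂ : Set V} (h₁ : G.HasDecomp m U₁ S₁)
    (h₂ : G.HasDecomp m U₂ S₂) (hS₁ : U₁ ∩ U₂ ⊆ S₁) (hS₂ : U₁ ∩ U₂ ⊆ S₂)
    (hadj : ∀ u ∈ U₁, ∀ v ∈ U₂, G.Adj u v → u ∈ U₂ ∨ v ∈ U₁) : G.HasDecomp m (U₁ ∪ U₂) S₁ := by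
  obtain ⟨N₁, _, T₁, r₁, b₁, ht₁, hc₁, hr₁, hs₁, ha₁, hv₁⟩ := h₁
  obtain ⟨N₂, _, T₂, r₂, b₂, ht₂, hc₂, hr₂, hs₂, ha₂, hv₂⟩ := h₂
  let T := (T₁ ⊕g T₂) ⊔ edge (.inl r₁) (.inr r₂)
  have hle : (T₁ ⊕g T₂) ≤ T := le_sup_left
  let i₁ : T₁ →g T := (Hom.ofLE hle).comp (Embedding.sumInl (G := T₁) (H := T₂)).toHom
  let i₂ : T₂ →g T := (Hom.ofLE hle).comp (Embedding.sumInr (G := T₁) (H := T₂)).toHom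
  have hT : T.Adj (.inl r₁) (.inr r₂) := by simp [T, edge_adj]
  refine ⟨N₁ ⊕ N₂, inferInstance, T, .inl r₁, Sum.elim b₁ b₂, ht₁.sum_sup_edge ht₂ r₁ r₂,
    ?_, hr₁, ?_, ?_, ?_⟩
  · rintro (t | t)
    · exact hc₁ t
    · exact hc₂ t
  · rintro (t | t)
    · exact (hs₁ t).trans Set.subset_union_left
    · exact (hs₂ t).trans Set.subset_union_right
  · have h1 : ∀ u ∈ U₁, ∀ v ∈ U₁, G.Adj u v → ∃ t, u ∈ Sum.elim b₁ b₂ t ∧ v ∈ Sum.elim b₁ b₂ t := by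
      intro u hu v hv h
      obtain ⟨t, ht⟩ := ha₁ u hu v hv h
      exact ⟨.inl t, ht⟩
    have h2 : ∀ u ∈ U₂, ∀ v ∈ U₂, G.Adj u v → ∃ t, u ∈ Sum.elim b₁ b₂ t ∧ v ∈ Sum.elim b₁ b₂ t := by
      intro u hu v hv h
      obtain ⟨t, ht⟩ := ha₂ u hu v hv h
      exact ⟨.inr t, ht⟩
    rintro u (hu | hu) v (hv | hv) h
    · exact h1 u hu v hv h
    · rcases hadj u hu v hv h with h' | h'
      · exact h2 u h' v hv h
      · exact h1 u hu v h' h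
    · rcases hadj v hv u hu h.symm with h' | h'
      · exact h2 u hu v h' h
      · exact h1 u h' v hv h
    · exact h2 u hu v hv h
  · have hset : ∀ v, {t | v ∈ Sum.elim b₁ b₂ t} = i₁ '' {t | v ∈ b₁ t} ∪ i₂ '' {t | v ∈ b₂ t} := by
      intro v
      ext (t | t) <;> simp [i₁, i₂]
    intro v hv
    rw [hset]
    have hne₁ : v ∉ U₁ → {t | v ∈ b₁ t} = ∅ := by
      intro h; ext t; simpa using fun h' => h (hs₁ t h')
    have hne₂ : v ∉ U₂ → {t | v ∈ b₂ t} = ∅ := by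
      intro h; ext t; simpa using fun h' => h (hs₂ t h')
    by_cases h1 : v ∈ U₁
    · by_cases h2 : v ∈ U₂
      · refine ((hv₁ v h1).image i₁).union ((hv₂ v h2).image i₂) ?_
        refine ⟨_, ⟨r₁, ?_, rfl⟩, _, ⟨r₂, ?_, rfl⟩, Or.inr hT⟩
        · have := hS₁ ⟨h1, h2⟩; rw [← hr₁] at this; exact this
        · have := hS₂ ⟨h1, h2⟩; rw [← hr₂] at this; exact this
      · rw [hne₂ h2, Set.image_empty, Set.union_empty]
        exact (hv₁ v h1).image i₁
    · have h2 : v ∈ U₂ := hv.resolve_left h1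
      rw [hne₁ h1, Set.image_empty, Set.empty_union]
      exact (hv₂ v h2).image i₂

/-- Decompositions of all pieces that `X` cuts off from `W` are combined at a bag `X`. -/
lemma hasDecomp_union_of_components [Finite V] {m : ℕ} {X : Set V} (hX : X.ncard ≤ m) {W : Set V}
    (hWX : Disjoint W X) (hW : G.bdry W ⊆ X)
    (h : ∀ F ⊆ W, G.Conn F → G.bdry F ⊆ X → G.HasDecomp m (F ∪ G.bdry F) (G.bdry F)) :
    G.HasDecomp m (X ∪ W) X := by
  induction hn : W.ncard using Nat.strong_induction_on generalizing W with
  | _ n ih =>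
  subst hn
  rcases W.eq_empty_or_nonempty with rfl | ⟨w, hw⟩
  · rw [Set.union_empty]; exact hasDecomp_self hX
  let F := G.compIn W w
  have hwF : w ∈ F := self_mem_compIn hw
  have hFW : F ⊆ W := compIn_subset _ _
  have hFd : Disjoint (G.bdry F) W := bdry_compIn_disjoint _ _
  have hF : G.bdry F ⊆ X := by
    intro v hv
    rcases bdry_subset_of_subset hFW hv with h' | h'
    · exact absurd h' (Set.disjoint_left.1 hFd hv)
    · exact hW h'
  have hlt : (W \ F).ncard < W.ncard :=
    Set.ncard_lt_ncard ⟨Set.sdiff_subset, fun h => (h hw).2 hwF⟩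
  have h1 := ih _ hlt (hWX.mono_left Set.sdiff_subset) (W := W \ F) ?_
    (fun F' hF' => h F' (hF'.trans Set.sdiff_subset)) rfl
  · have h2 := h F hFW (conn_compIn hw) hF
    have hint : (X ∪ W \ F) ∩ (F ∪ G.bdry F) ⊆ G.bdry F := by
      rintro v ⟨hv, hvF | hvF⟩
      · rcases hv with hv | hv
        · exact absurd hv (Set.disjoint_left.1 hWX (hFW hvF))
        · exact absurd hvF hv.2
      · exact hvF
    have := h1.glue h2 (hint.trans hF) hint ?_
    · convert this using 1
      ext v
      simp only [Set.mem_union, Set.mem_sdiff]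
      have : v ∈ F → v ∈ W := @hFW v
      have : v ∈ G.bdry F → v ∈ X := @hF v
      tauto
    · rintro u hu v (hv | hv) hadj
      · left
        by_cases huF : u ∈ F
        · exact Or.inl huF
        · exact Or.inr ⟨huF, v, hv, hadj.symm⟩
      · exact Or.inr (Or.inl (hF hv))
  · rintro v ⟨hv, e, he, hadj⟩
    -- If v ∈ F, then e ∈ W would lie in the boundary of F, hence in X.
    by_cases hvF : v ∈ F
    · exact absurd (hF ⟨he.2, v, hvF, hadj.symm⟩) (Set.disjoint_left.1 hWX he.1)
    · exact hW ⟨fun h => hv ⟨h, hvF⟩, e, he.1, hadj⟩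

/-! ### Passing a ring on to a smaller set -/

namespace IsRing

variable {E F : Set V} {cs : List V} {B : V → Set V}

lemma pairwise (h : G.IsRing E cs B) : cs.Pairwise fun a b => Disjoint (B a) (B b) :=
  List.pairwise_map.1 h.necklace.pairwise

lemma eq_of_mem (h : G.IsRing E cs B) {c v : V} (hc : c ∈ cs) (hv : v ∈ cs) (hvc : v ∈ B c) :
    v = c := by
  by_contra hne
  have : Std.Symm fun a b => Disjoint (B a) (B b) := ⟨fun _ _ h => h.symm⟩
  exact Set.disjoint_left.1 (h.pairwise.forall hc hv (Ne.symm hne)) hvc (h.mem_self v hv)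

lemma disjoint_left (h : G.IsRing E cs B) {c : V} (hc : c ∈ cs) : Disjoint (B c) E :=
  h.necklace.disjoint_left _ (List.mem_map_of_mem hc)

lemma conn (h : G.IsRing E cs B) {c : V} (hc : c ∈ cs) : G.Conn (B c) :=
  h.necklace.conn _ (List.mem_map_of_mem hc)

lemma mem_of_mem_bdry (h : G.IsRing E cs B) (hF : F ⊆ E) {v : V} (hv : v ∈ G.bdry F)
    (hvE : v ∉ E) : v ∈ cs :=
  (h.mem_iff v).2 ((bdry_subset_of_subset hF hv).resolve_left hvE)

/-- Outside E, a boundary vertex of F is a ring member of E, and `B c` contains no ring member but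
c. -/
lemma subsingleton_inter (h : G.IsRing E cs B) (hF : F ⊆ E) {c : V} (hc : c ∈ cs) :
    (B c ∩ G.bdry F).Subsingleton := by
  have key : ∀ v ∈ B c ∩ G.bdry F, v = c := fun v hv =>
    h.eq_of_mem hc (h.mem_of_mem_bdry hF hv.2 (Set.disjoint_left.1 (h.disjoint_left hc) hv.1)) hv.1
  exact fun v hv w hw => (key v hv).trans (key w hw).symm

/-- A ring around `E` is extended to a ring around `F ⊆ E` by inserting a chain of subsets
of `E \ F` between its last and its first member. -/
lemma ringed_of_append (h : G.IsRing E cs B) (hF : F ⊆ E) {M : List V} (hM : cs ~r M)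
    (hMne : M ≠ []) {Q : List (Set V)} (hconn : ∀ A ∈ Q, G.Conn A) (hQE : ∀ A ∈ Q, A ⊆ E \ F)
    (hdisj : Q.Pairwise Disjoint) (hchain : Q.IsChain G.Touch) (hne : Q ≠ [])
    (hlast : ∀ x ∈ M.getLast?, ∀ A ∈ Q.head?, G.Touch (B x) A)
    (hhead : ∀ A ∈ Q.getLast?, ∀ y ∈ M.head?, G.Touch A (B y))
    (hsub : ∀ A ∈ Q, (A ∩ G.bdry F).Subsingleton)
    (hcov : ∀ v ∈ G.bdry F ∩ E, ∃ A ∈ Q, v ∈ A) : G.Ringed F := by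
  have hrot := h.necklace.rotate (hM.map B)
  have hmem : ∀ c, c ∈ cs ↔ c ∈ M := fun c => hM.mem_iff
  refine ringed_of_isNecklace (L := M.map B ++ Q) ⟨?_, ?_, ?_, ?_⟩ ?_ ?_
  · intro A hA
    rcases List.mem_append.1 hA with hA | hA
    · exact hrot.conn A hA
    · exact hconn A hA
  · intro A hA
    rcases List.mem_append.1 hA with hA | hA
    · exact (hrot.disjoint_left A hA).mono_right hF
    · exact Set.disjoint_left.2 fun v hv => (hQE A hA hv).2
  · rw [List.pairwise_append]
    exact ⟨hrot.pairwise, hdisj, fun A hA A' hA' =>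
      (hrot.disjoint_left A hA).mono_right ((hQE A' hA').trans Set.sdiff_subset)⟩
  · rcases M with _ | ⟨a, l⟩
    · exact absurd rfl hMne
    have hc := hrot.chain
    rw [List.map_cons, Cycle.chain_coe_cons, ← List.cons_append, ← List.map_cons,
      List.isChain_append] at hc
    rw [List.map_cons, List.cons_append, Cycle.chain_coe_cons, ← List.cons_append,
      ← List.cons_append, ← List.map_cons, List.isChain_append, List.isChain_append]
    refine ⟨⟨hc.1, hchain, ?_⟩, List.isChain_singleton _, ?_⟩
    · intro x hx A hA
      rw [List.getLast?_map, Option.mem_map] at hx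
      obtain ⟨x, hx, rfl⟩ := hx
      exact hlast x hx A hA
    · intro A hA y hy
      obtain rfl : B a = y := by simpa using hy
      rw [List.getLast?_append_of_ne_nil _ hne] at hA
      exact hhead A hA a rfl
  · intro A hA
    rcases List.mem_append.1 hA with hA | hA
    · obtain ⟨c, hc, rfl⟩ := List.mem_map.1 hA
      exact h.subsingleton_inter hF ((hmem c).2 hc)
    · exact hsub A hA
  · intro v hv
    by_cases hvE : v ∈ E
    · obtain ⟨A, hA, hvA⟩ := hcov v ⟨hv, hvE⟩
      exact ⟨A, List.mem_append_right _ hA, hvA⟩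
    · have hvc := h.mem_of_mem_bdry hF hv hvE
      exact ⟨B v, List.mem_append_left _ (List.mem_map_of_mem ((hmem v).1 hvc)), h.mem_self v hvc⟩

/-- If `F ⊆ E` does not see some vertex `z` of the boundary of `E`, then `z` may be replaced by the
only vertex of `E` that `F` sees. -/
lemma ringed_of_replace (h : G.IsRing E cs B) (hF : F ⊆ E) (hR : G.Conn (E \ F))
    (hsub : (G.bdry F ∩ E).Subsingleton) {z : V} (hz : z ∈ G.bdry E) (hzF : z ∉ G.bdry F) :
    G.Ringed F := by
  classical
  have hzc := (h.mem_iff z).2 hz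
  -- Since F does not see z, the member around z carries no boundary vertex of F and has room for
  -- the only one in E.
  let B' : V → Set V := fun c => if c = z then B c ∪ E \ F else B c
  have hB' : ∀ c, B c ⊆ B' c := by
    intro c; by_cases hc : c = z <;> simp [B', hc]
  have htouch : G.Touch (B z) (E \ F) := by
    obtain ⟨hzE, e, he, hadj⟩ := id hz
    exact ⟨z, h.mem_self z hzc, e, ⟨he, fun heF => hzF ⟨fun h => hzE (hF h), e, heF, hadj⟩⟩,
      Or.inr hadj.symm⟩
  refine ringed_of_isNecklace (L := cs.map B') ⟨?_, ?_, ?_, ?_⟩ ?_ ?_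
  · intro A hA
    obtain ⟨c, hc, rfl⟩ := List.mem_map.1 hA
    by_cases hcz : c = z
    · subst hcz
      simpa [B'] using (h.conn hc).union hR htouch
    · simpa [B', hcz] using h.conn hc
  · intro A hA
    obtain ⟨c, hc, rfl⟩ := List.mem_map.1 hA
    have := (h.disjoint_left hc).mono_right hF
    by_cases hcz : c = z
    · simpa [B', hcz] using ⟨hcz ▸ this, disjoint_sdiff_self_left⟩
    · simpa [B', hcz] using this
  · rw [List.pairwise_map]
    refine (h.pairwise.and h.nodup).imp_of_mem ?_
    rintro a b ha hb ⟨hab, hne⟩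
    have hda := (h.disjoint_left ha).mono_right (Set.sdiff_subset (s := E) (t := F))
    have hdb := (h.disjoint_left hb).mono_right (Set.sdiff_subset (s := E) (t := F))
    by_cases haz : a = z
    · have hbz : b ≠ z := fun h => hne (haz.trans h.symm)
      simp only [B', if_pos haz, if_neg hbz]
      exact Set.disjoint_union_left.2 ⟨hab, hdb.symm⟩
    · by_cases hbz : b = z
      · simp only [B', if_pos hbz, if_neg haz]
        exact Set.disjoint_union_right.2 ⟨hab, hda⟩
      · simpa only [B', if_neg hbz, if_neg haz] using hab
  · have hc := h.necklace.chain
    rw [← Cycle.map_coe, Cycle.chain_map] at hc ⊢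
    exact hc.imp fun a b hab => hab.mono (hB' a) (hB' b)
  · intro A hA
    obtain ⟨c, hc, rfl⟩ := List.mem_map.1 hA
    by_cases hcz : c = z
    · subst hcz
      have : B c ∩ G.bdry F = ∅ := by
        ext v
        simp only [Set.mem_inter_iff, Set.mem_empty_iff_false, iff_false]
        rintro ⟨hv, hvF⟩
        have := h.eq_of_mem hc
          (h.mem_of_mem_bdry hF hvF (Set.disjoint_left.1 (h.disjoint_left hc) hv)) hv
        exact hzF (this ▸ hvF)
      simp only [B', if_pos]
      rw [Set.union_inter_distrib_right, this, Set.empty_union]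
      exact hsub.anti fun v hv => ⟨hv.2, hv.1.1⟩
    · simpa [B', hcz] using h.subsingleton_inter hF hc
  · intro v hv
    by_cases hvE : v ∈ E
    · exact ⟨B' z, List.mem_map_of_mem hzc, by simp [B', hvE, hv.1]⟩
    · have hvc := h.mem_of_mem_bdry hF hv hvE
      exact ⟨B' v, List.mem_map_of_mem hvc, hB' v (h.mem_self v hvc)⟩

end IsRing

/-- If `E` has at most one boundary vertex, then one vertex of `E` cuts it into ringed pieces. -/
lemma exists_separator_of_length_le_one {E : Set V} (hE : G.Conn E) {cs : List V} {B : V → Set V}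
    (h : G.IsRing E cs B) (hcs : cs.length ≤ 1) :
    ∃ x ∈ E, ∀ F ⊆ E \ {x}, G.bdry F ⊆ G.bdry E ∪ {x} → G.Ringed F := by
  rcases cs with _ | ⟨c, _ | ⟨d, l⟩⟩
  · obtain ⟨x, hx⟩ := hE.nonempty
    have hbE : G.bdry E = ∅ := by
      ext v; simp [← h.mem_iff v]
    refine ⟨x, hx, fun F hF hbF => ringed_of_isNecklace (L := [{x}]) ⟨?_, ?_, ?_, ?_⟩ ?_ ?_⟩
    · simpa using conn_singleton x
    · simpa using fun hxF => (hF hxF).2 rfl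
    · simp
    -- `Touch` permits equality, so a necklace with one member closes up on itself.
    · rw [Cycle.chain_singleton]; exact ⟨x, rfl, x, rfl, Or.inl rfl⟩
    · simpa using Set.subsingleton_singleton.anti Set.inter_subset_left
    · intro v hv
      exact ⟨{x}, by simp, by simpa [hbE] using hbF hv⟩
  · obtain ⟨hcE, x, hx, hadj⟩ := (h.mem_iff c).1 (by simp)
    have htouch : G.Touch (B c) {x} :=
      ⟨c, h.mem_self c (by simp), x, rfl, Or.inr hadj.symm⟩
    refine ⟨x, hx, fun F hF hbF => h.ringed_of_append (hF.trans Set.sdiff_subset)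
      (List.IsRotated.refl _) (by simp) (Q := [{x}]) ?_ ?_ ?_ ?_ (by simp) ?_ ?_ ?_ ?_⟩
    · simpa using conn_singleton x
    · simpa using ⟨hx, fun hxF => (hF hxF).2 rfl⟩
    · simp
    · simp
    · simpa using htouch
    · simpa using htouch.symm
    · simpa using Set.subsingleton_singleton.anti Set.inter_subset_left
    · rintro v ⟨hv, hvE⟩
      exact ⟨{x}, by simp, (hbF hv).resolve_left fun h => h.1 hvE⟩
  · simp at hcs

/-! ### Consecutive ring members and maximal cores -/

lemma _root_.List.exists_eq_append_cons_of_exists {α : Type*} {P : α → Prop} {p : List α}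
    (h : ∃ x ∈ p, P x) : ∃ p₁ x p₂, p = p₁ ++ x :: p₂ ∧ P x ∧ ∀ y ∈ p₁, ¬ P y := by
  induction p with
  | nil => simp at h
  | cons a l ih =>
    by_cases ha : P a
    · exact ⟨[], a, l, rfl, ha, by simp⟩
    · obtain ⟨x, hx, hPx⟩ := h
      have hxl : x ∈ l := by
        rcases List.mem_cons.1 hx with rfl | hx
        · exact absurd hPx ha
        · exact hx
      obtain ⟨p₁, y, p₂, rfl, hy, hp⟩ := ih ⟨x, hxl, hPx⟩
      exact ⟨a :: p₁, y, p₂, rfl, hy, by simpa [ha] using hp⟩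

lemma _root_.List.exists_eq_append_cons_of_exists' {α : Type*} {P : α → Prop} {p : List α}
    (h : ∃ x ∈ p, P x) : ∃ p₁ x p₂, p = p₁ ++ x :: p₂ ∧ P x ∧ ∀ y ∈ p₂, ¬ P y := by
  obtain ⟨p₁, x, p₂, hp, hx, hy⟩ := List.exists_eq_append_cons_of_exists (p := p.reverse) (P := P)
    (by simpa using h)
  refine ⟨p₂.reverse, x, p₁.reverse, ?_, hx, by simpa using hy⟩
  have := congrArg List.reverse hp
  simpa using this

/-- The vertices `t` and `t'` are adjacent in the cyclic order given by `cs`. -/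
def Consec (cs : List V) (t t' : V) : Prop :=
  ∃ l, cs ~r t' :: (l ++ [t]) ∨ cs ~r t :: (l ++ [t'])

lemma Consec.symm {cs : List V} {t t' : V} (h : Consec cs t t') : Consec cs t' t := by
  obtain ⟨l, h⟩ := h
  exact ⟨l, h.symm⟩

lemma Consec.mem {cs : List V} {t t' : V} (h : Consec cs t t') : t ∈ cs := by
  obtain ⟨l, h | h⟩ := h <;> rw [h.mem_iff] <;> simp

lemma isChain_consec {cs M : List V} (h : cs ~r M) : M.IsChain (Consec cs) := by
  rw [List.isChain_iff_forall_rel_of_append_cons_cons]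
  rintro a b l₁ l₂ rfl
  refine ⟨l₂ ++ l₁, Or.inl (h.trans ?_)⟩
  simpa using List.isRotated_append (l := l₁ ++ [a]) (l' := b :: l₂)

/-- A connected subset `D` of the ringed set `E` that is as large as possible subject to leaving
room for a connected subset of `E \ D` that sees two consecutive members of the ring: every such
subset contains all attachments of `D` in `E`. Moreover no single vertex of `E` cuts off the
remainder of `E` from the boundary of `E`. -/
structure IsMaxCore (G : SimpleGraph V) (E : Set V) (cs : List V) (B : V → Set V) (D : Set V) :
    Prop where
  ring : G.IsRing E cs B
  conn : G.Conn E
  avoid : ∀ x ∈ E, ∃ K ⊆ E \ {x}, G.Conn K ∧ G.bdry E ⊆ G.bdry K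
  conn_core : G.Conn D
  subset : D ⊆ E
  sees : ∃ U ⊆ E \ D, G.Conn U ∧ ∃ t t', Consec cs t t' ∧ t ∈ G.bdry U ∧ t' ∈ G.bdry U
  attach_subset : ∀ U ⊆ E \ D, G.Conn U → ∀ t t', Consec cs t t' → t ∈ G.bdry U → t' ∈ G.bdry U →
    G.bdry D ∩ E ⊆ U

/-- A singleton is a candidate by `havoid`. In an inclusion-maximal candidate, an attachment missed
by U could be added to D. -/
lemma exists_isMaxCore [Finite V] {E : Set V} {cs : List V} {B : V → Set V}
    (hring : G.IsRing E cs B) (hE : G.Conn E)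
    (havoid : ∀ x ∈ E, ∃ K ⊆ E \ {x}, G.Conn K ∧ G.bdry E ⊆ G.bdry K) (hcs : 2 ≤ cs.length) :
    ∃ D, G.IsMaxCore E cs B D := by
  let P : Set (Set V) := {D | G.Conn D ∧ D ⊆ E ∧
    ∃ U ⊆ E \ D, G.Conn U ∧ ∃ t t', Consec cs t t' ∧ t ∈ G.bdry U ∧ t' ∈ G.bdry U}
  have hne : P.Nonempty := by
    obtain ⟨x, hx⟩ := hE.nonempty
    obtain ⟨K, hK, hKc, hKb⟩ := havoid x hx
    obtain ⟨t, t', h⟩ : ∃ t t', Consec cs t t' := by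
      have h := isChain_consec (List.IsRotated.refl cs)
      rcases cs with _ | ⟨a, _ | ⟨b, l⟩⟩
      · simp at hcs
      · simp at hcs
      · exact ⟨a, b, (List.isChain_cons_cons.1 h).1⟩
    exact ⟨{x}, conn_singleton x, by simpa using hx, K, hK, hKc, t, t', h,
      hKb ((hring.mem_iff t).1 h.mem), hKb ((hring.mem_iff t').1 h.symm.mem)⟩
  obtain ⟨D, hD, hmax⟩ := P.toFinite.exists_maximal hne
  refine ⟨D, hring, hE, havoid, hD.1, hD.2.1, hD.2.2, ?_⟩
  rintro U hU hUc t t' htt ht ht' s ⟨hs, hsE⟩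
  by_contra hsU
  have hDs : D ∪ {s} ∈ P := by
    refine ⟨hD.1.union (conn_singleton s) (touch_of_mem_bdry hs rfl),
      Set.union_subset hD.2.1 (by simpa using hsE), U, ?_, hUc, t, t', htt, ht, ht'⟩
    intro u hu
    refine ⟨(hU hu).1, ?_⟩
    rintro (h | rfl)
    · exact (hU hu).2 h
    · exact hsU hu
  exact hs.1 (hmax hDs Set.subset_union_left (Or.inr rfl))

namespace IsMaxCore

variable {E D F : Set V} {cs : List V} {B : V → Set V}

lemma nonempty_attach (h : G.IsMaxCore E cs B D) : (G.bdry D ∩ E).Nonempty := by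
  obtain ⟨U, hU, hUc, -⟩ := h.sees
  obtain ⟨u, hu⟩ := hUc.nonempty
  obtain ⟨a, ha, b, hb, hab⟩ := h.conn.exists_adj h.subset h.conn_core.nonempty ⟨u, hU hu⟩
  exact ⟨b, ⟨hb.2, a, ha, hab⟩, hb.1⟩

/-- Some connected subset of E \ D contains all attachments of D, so removing D does not disconnect
E. -/
lemma conn_rest (h : G.IsMaxCore E cs B D) : G.Conn (E \ D) := by
  obtain ⟨U, hU, hUc, t, t', htt, ht, ht'⟩ := h.sees
  exact h.conn.diff hUc hU (h.attach_subset U hU hUc t t' htt ht ht')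

lemma conn_union_of_subset_attach {D S : Set V} (hD : G.Conn D) (hS : S ⊆ G.bdry D) :
    G.Conn (D ∪ S) := by
  obtain ⟨d, hd⟩ := hD.nonempty
  refine G.induce_connected_of_patches d (Or.inl hd) ?_
  rintro v (hv | hv)
  · exact ⟨D, Set.subset_union_left, hd, hv, hD.preconnected _ _⟩
  · refine ⟨D ∪ {v}, Set.union_subset_union_right _ (by simpa using hv), Or.inl hd, Or.inr rfl, ?_⟩
    exact (hD.union (conn_singleton v) (touch_of_mem_bdry (hS hv) rfl)).preconnected _ _

lemma notMem_of_consec (h : G.IsMaxCore E cs B D) {t t' : V} (htt : Consec cs t t') : t ∉ E :=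
  ((h.ring.mem_iff t).1 htt.mem).1

/-- The vertex set of any path through E \ D between neighbours of t and t' is a set to which
maximality applies, so it contains all attachments. -/
lemma exists_path (h : G.IsMaxCore E cs B D) {t t' : V} (htt : Consec cs t t')
    (ht : t ∈ G.bdry (E \ D)) (ht' : t' ∈ G.bdry (E \ D)) :
    ∃ p : List V, p.Nodup ∧ p.IsChain G.Adj ∧ (∀ v ∈ p, v ∈ E \ D) ∧ p ≠ [] ∧
      (∀ x ∈ p.head?, G.Adj x t) ∧ (∀ y ∈ p.getLast?, G.Adj y t') ∧ ∀ v ∈ G.bdry D ∩ E, v ∈ p := by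
  obtain ⟨-, x, hx, hxt⟩ := ht
  obtain ⟨-, y, hy, hyt⟩ := ht'
  obtain ⟨p, hnd, hch, hhead, hlast, hpR⟩ := h.conn_rest.exists_path hx hy
  have hp : p ≠ [] := by rintro rfl; simp at hhead
  refine ⟨p, hnd, hch, hpR, hp, ?_, ?_, ?_⟩
  · simpa [hhead] using hxt
  · simpa [hlast] using hyt
  · refine h.attach_subset {v | v ∈ p} hpR (conn_of_isChain hch hp) t t' htt ?_ ?_
    · exact ⟨fun htp => h.notMem_of_consec htt (hpR t htp).1, x, List.mem_of_mem_head? hhead, hxt⟩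
    · exact ⟨fun htp => h.notMem_of_consec htt.symm (hpR t' htp).1, y,
        List.mem_of_mem_getLast? hlast, hyt⟩

/-- If consecutive members `t`, `t'` of the ring are both seen by `E \ D`, then `t` is also seen
by `D`. -/
lemma mem_bdry_core (h : G.IsMaxCore E cs B D) {t t' : V} (htt : Consec cs t t')
    (ht : t ∈ G.bdry (E \ D)) (ht' : t' ∈ G.bdry (E \ D)) : t ∈ G.bdry D := by
  by_contra htD
  have htE := h.notMem_of_consec htt
  have htE' := h.notMem_of_consec htt.symm
  obtain ⟨p, hnd, hch, hpR, hp, -, hlast, hSp⟩ := h.exists_path htt ht ht'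
  obtain ⟨p₁, s, p₂, rfl, hs, hp₁⟩ := List.exists_eq_append_cons_of_exists
    (P := fun v => v ∈ G.bdry D ∩ E) (p := p)
    (by obtain ⟨s, hs⟩ := h.nonempty_attach; exact ⟨s, hSp s hs, hs⟩)
  obtain ⟨K, hK, hKc, hKb⟩ := h.avoid s hs.2
  obtain ⟨-, w, hw, hwt⟩ := hKb ((h.ring.mem_iff t).1 htt.mem)
  have hwD : w ∉ D := fun hwD => htD ⟨fun h' => htE (h.subset h'), w, hwD, hwt⟩
  -- W sees t and avoids s, the first attachment on the path. The aim is to extend W to a set that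
  -- also sees t' but still misses s, against maximality.
  let W := G.compIn (K \ D) w
  have hWK : W ⊆ K \ D := compIn_subset _ _
  have hWc : G.Conn W := conn_compIn ⟨hw, hwD⟩
  have hwW : w ∈ W := self_mem_compIn ⟨hw, hwD⟩
  have hWR : W ⊆ E \ D := fun v hv => ⟨(hK (hWK hv).1).1, (hWK hv).2⟩
  have hsW : s ∉ W := fun hsW => (hK (hWK hsW).1).2 rfl
  have hmeet : ∃ r ∈ W, r ∈ G.bdry D ∩ E := by
    by_contra hcon
    push Not at hcon
    -- Without an attachment, W has no edge to D and is therefore all of K, which already sees t'.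
    have hKW : K ⊆ W := by
      by_contra hcon'
      rw [Set.not_subset] at hcon'
      obtain ⟨v, hv, hvW⟩ := hcon'
      obtain ⟨a, ha, b, hb, hab⟩ := hKc.exists_adj (fun v hv => (hWK hv).1) ⟨w, hwW⟩ ⟨v, hv, hvW⟩
      by_cases hbD : b ∈ D
      · exact hcon a ha ⟨⟨(hWR ha).2, b, hbD, hab.symm⟩, (hWR ha).1⟩
      · exact hb.2 (mem_compIn_of_adj ha ⟨hb.1, hbD⟩ hab)
    exact hsW (h.attach_subset W hWR hWc t t' htt
      (mem_bdry_mono hKW (hKb ((h.ring.mem_iff t).1 htt.mem)) fun h' => htE (hWR h').1)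
      (mem_bdry_mono hKW (hKb ((h.ring.mem_iff t').1 htt.symm.mem)) fun h' => htE' (hWR h').1) hs)
  obtain ⟨r, hrW, hr⟩ := hmeet
  have hrp : r ∈ p₂ := by
    have := hSp r hr
    rw [List.mem_append, List.mem_cons] at this
    rcases this with h' | rfl | h'
    · exact absurd hr (hp₁ r h')
    · exact absurd hrW hsW
    · exact h'
  have hp₂ : p₂ ≠ [] := List.ne_nil_of_mem hrp
  have hp₂c : p₂.IsChain G.Adj := (List.IsChain.right_of_append hch).tail
  have hUR : W ∪ {v | v ∈ p₂} ⊆ E \ D :=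
    Set.union_subset hWR fun v hv => hpR v (by simp [show v ∈ p₂ from hv])
  -- The tail of the path after s meets W in r and leads to t'.
  have hsU := h.attach_subset (W ∪ {v | v ∈ p₂}) hUR
    (hWc.union (conn_of_isChain hp₂c hp₂) ⟨r, hrW, r, hrp, Or.inl rfl⟩) t t' htt
    ⟨fun h' => htE (hUR h').1, w, Or.inl hwW, hwt⟩ ?_ hs
  · rcases hsU with h' | h'
    · exact hsW h'
    · have := (List.nodup_append.1 hnd).2.1
      exact (List.nodup_cons.1 this).1 h'
  · refine ⟨fun h' => htE' (hUR h').1, p₂.getLast hp₂, Or.inr (List.getLast_mem hp₂), hlast _ ?_⟩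
    rw [List.getLast?_append_of_ne_nil _ (by simp), List.getLast?_cons_of_ne_nil hp₂]
    exact List.getLast?_eq_some_getLast hp₂

end IsMaxCore

namespace IsMaxCore

variable {E D F : Set V} {cs : List V} {B : V → Set V}

/-- There are consecutive members of the ring joined by a path through `E \ D`. -/
lemma exists_consec_path (h : G.IsMaxCore E cs B D) :
    ∃ (a b : V) (l : List V), cs ~r b :: (l ++ [a]) ∧ a ∈ G.bdry (E \ D) ∧ b ∈ G.bdry (E \ D) ∧
      Consec cs a b := by
  obtain ⟨U, hU, hUc, t, t', htt, ht, ht'⟩ := h.sees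
  have ht := mem_bdry_mono hU ht fun h' => h.notMem_of_consec htt h'.1
  have ht' := mem_bdry_mono hU ht' fun h' => h.notMem_of_consec htt.symm h'.1
  obtain ⟨l, hl | hl⟩ := id htt
  · exact ⟨t, t', l, hl, ht, ht', htt⟩
  · exact ⟨t', t, l, hl, ht', ht, htt.symm⟩

/-- The vertices of the path, as singletons, close the ring between a and b. They cover all
attachments of D in E. -/
lemma ringed_core (h : G.IsMaxCore E cs B D) : G.Ringed D := by
  obtain ⟨a, b, l, hl, ha, hb, hab⟩ := h.exists_consec_path
  obtain ⟨p, hnd, hch, hpR, hp, hhead, hlast, hSp⟩ := h.exists_path hab ha hb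
  refine h.ring.ringed_of_append h.subset hl (by simp) (Q := p.map fun v => {v}) ?_ ?_ ?_ ?_
    (by simpa using hp) ?_ ?_ ?_ ?_
  · intro A hA
    obtain ⟨v, -, rfl⟩ := List.mem_map.1 hA
    exact conn_singleton v
  · intro A hA
    obtain ⟨v, hv, rfl⟩ := List.mem_map.1 hA
    simpa using hpR v hv
  · rw [List.pairwise_map]
    exact hnd.imp fun hne => by simpa using hne
  · rw [List.isChain_map]
    exact hch.imp fun v w hvw => ⟨v, rfl, w, rfl, Or.inr hvw⟩
  · intro x hx A hA
    obtain rfl : a = x := by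
      rw [← List.cons_append, List.getLast?_append_of_ne_nil _ (by simp)] at hx
      simpa using hx
    rw [List.head?_map, Option.mem_map] at hA
    obtain ⟨v, hv, rfl⟩ := hA
    exact ⟨a, h.ring.mem_self a hab.mem, v, rfl, Or.inr (hhead v hv).symm⟩
  · intro A hA y hy
    obtain rfl : b = y := by simpa using hy
    rw [List.getLast?_map, Option.mem_map] at hA
    obtain ⟨v, hv, rfl⟩ := hA
    exact ⟨v, rfl, b, h.ring.mem_self b hab.symm.mem, Or.inr (hlast v hv)⟩
  · intro A hA
    obtain ⟨v, -, rfl⟩ := List.mem_map.1 hA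
    exact Set.subsingleton_singleton.anti Set.inter_subset_left
  · intro v hv
    exact ⟨{v}, List.mem_map_of_mem (hSp v hv), rfl⟩

/-- Two parts of a path joining consecutive members of the ring, linked by a set that both parts
touch, contain all attachments of `D`. -/
lemma attach_subset_of_lists (h : G.IsMaxCore E cs B D) {t t' : V} (htt : Consec cs t t')
    {q₁ q₂ : List V} (hq₁ : q₁.IsChain G.Adj) (hq₂ : q₂.IsChain G.Adj)
    (hR₁ : ∀ v ∈ q₁, v ∈ E \ D) (hR₂ : ∀ v ∈ q₂, v ∈ E \ D) (hF : G.Conn F) (hFR : F ⊆ E \ D)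
    (ht₁ : G.Touch {v | v ∈ q₁} F) (ht₂ : G.Touch F {v | v ∈ q₂})
    (hhead : ∀ x ∈ q₁.head?, G.Adj x t) (hlast : ∀ y ∈ q₂.getLast?, G.Adj y t') :
    G.bdry D ∩ E ⊆ {v | v ∈ q₁} ∪ F ∪ {v | v ∈ q₂} := by
  have hne₁ : q₁ ≠ [] := by
    obtain ⟨a, ha, -⟩ := ht₁; exact List.ne_nil_of_mem ha
  have hne₂ : q₂ ≠ [] := by
    obtain ⟨_, -, b, hb, -⟩ := ht₂; exact List.ne_nil_of_mem hb
  have hU : {v | v ∈ q₁} ∪ F ∪ {v | v ∈ q₂} ⊆ E \ D :=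
    Set.union_subset (Set.union_subset hR₁ hFR) hR₂
  refine h.attach_subset _ hU ?_ t t' htt ?_ ?_
  · exact (((conn_of_isChain hq₁ hne₁).union hF ht₁).union (conn_of_isChain hq₂ hne₂)
      (ht₂.mono Set.subset_union_right subset_rfl))
  · exact ⟨fun h' => h.notMem_of_consec htt (hU h').1, q₁.head hne₁,
      Or.inl (Or.inl (List.head_mem hne₁)), hhead _ (List.head?_eq_some_head hne₁)⟩
  · exact ⟨fun h' => h.notMem_of_consec htt.symm (hU h').1, q₂.getLast hne₂,
      Or.inr (List.getLast_mem hne₂), hlast _ (List.getLast?_eq_some_getLast hne₂)⟩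

/-- If F has at least two attachments in E, rerouting the path through F shows by maximality that
they are exactly two path vertices s and s'. The two outer pieces of the path, linked through D,
then complete a ring around F. -/
lemma ringed_rest (h : G.IsMaxCore E cs B D) (hF : F ⊆ E \ D) (hFc : G.Conn F)
    (hFS : Disjoint F (G.bdry D)) (hFb : G.bdry F ∩ E ⊆ G.bdry D) : G.Ringed F := by
  obtain ⟨a, b, l, hl, ha, hb, hab⟩ := h.exists_consec_path
  have hFE : F ⊆ E := hF.trans Set.sdiff_subset
  obtain ⟨s₀, hs₀⟩ := h.nonempty_attach
  have hDF : Disjoint D F := Set.disjoint_left.2 fun v hv hvF => (hF hvF).2 hv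
  by_cases hsub : (G.bdry F ∩ E).Subsingleton
  -- If F saw the whole boundary of E, maximality would put the attachments of D into F.
  · have hz : ∃ z ∈ G.bdry E, z ∉ G.bdry F := by
      by_contra hcon
      push Not at hcon
      have := h.attach_subset F hF hFc a b hab (hcon a ((h.ring.mem_iff a).1 hab.mem))
        (hcon b ((h.ring.mem_iff b).1 hab.symm.mem)) hs₀
      exact Set.disjoint_left.1 hFS this hs₀.1
    obtain ⟨z, hz, hzF⟩ := hz
    refine h.ring.ringed_of_replace hFE ?_ hsub hz hzF
    refine h.conn.diff (conn_union_of_subset_attach h.conn_core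
      (Set.inter_subset_left (s := G.bdry D) (t := E))) ?_ ?_
    · rintro v (hv | hv)
      · exact ⟨h.subset hv, Set.disjoint_left.1 hDF hv⟩
      · exact ⟨hv.2, fun hvF => Set.disjoint_left.1 hFS hvF hv.1⟩
    · exact fun v hv => Or.inr ⟨hFb hv, hv.2⟩
  obtain ⟨p, hnd, hch, hpR, hp, hhead, hlast, hSp⟩ := h.exists_path hab ha hb
  have hSp' : ∀ v ∈ G.bdry F ∩ E, v ∈ p := fun v hv => hSp v ⟨hFb hv, hv.2⟩
  rw [Set.not_subsingleton_iff] at hsub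
  obtain ⟨p₁, s, p₂, rfl, hs, hp₁⟩ := List.exists_eq_append_cons_of_exists
    (P := fun v => v ∈ G.bdry F ∩ E) (p := p)
    (by obtain ⟨s, hs⟩ := hsub.nonempty; exact ⟨s, hSp' s hs, hs⟩)
  obtain ⟨r, hr, hrs⟩ := hsub.exists_ne s
  have hrp : r ∈ p₂ := by
    have := hSp' r hr
    rw [List.mem_append, List.mem_cons] at this
    rcases this with h' | h' | h'
    · exact absurd hr (hp₁ r h')
    · exact absurd h' hrs
    · exact h'
  obtain ⟨p₃, s', p₄, rfl, hs', hp₄⟩ := List.exists_eq_append_cons_of_exists'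
    (P := fun v => v ∈ G.bdry F ∩ E) (p := p₂) ⟨r, hrp, hr⟩
  clear hrp hrs hr r
  have hnd' := hnd
  simp only [List.nodup_append, List.nodup_cons, List.mem_append, List.mem_cons, not_or] at hnd'
  have hne : s ≠ s' := hnd'.2.1.1.2.1
  have hsF : s ∉ F := fun hsF => hs.1.1 hsF
  have hsF' : s' ∉ F := fun hsF => hs'.1.1 hsF
  have hch₁ : (p₁ ++ [s]).IsChain G.Adj := (List.isChain_split.1 hch).1
  have hch₂ : (s' :: p₄).IsChain G.Adj :=
    ((List.isChain_split.1 hch).2.tail : (p₃ ++ s' :: p₄).IsChain G.Adj).right_of_append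
  have hR₁ : ∀ v ∈ p₁ ++ [s], v ∈ E \ D := fun v hv => hpR v (by
    simp only [List.mem_append, List.mem_cons, List.not_mem_nil, or_false] at hv ⊢; tauto)
  have hR₂ : ∀ v ∈ s' :: p₄, v ∈ E \ D := fun v hv => hpR v (by
    simp only [List.mem_append, List.mem_cons] at hv ⊢; tauto)
  have hhead₁ : ∀ x ∈ (p₁ ++ [s]).head?, G.Adj x a := by
    intro x hx; apply hhead x
    rcases p₁ with _ | ⟨y, p₁⟩ <;> simpa using hx
  have hlast₂ : ∀ y ∈ (s' :: p₄).getLast?, G.Adj y b := by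
    intro x hx; apply hlast x
    rw [← List.cons_append, ← List.append_assoc, List.getLast?_append_of_ne_nil _ (by simp)]
    exact hx
  have htouch₁ : G.Touch {v | v ∈ p₁ ++ [s]} F :=
    (touch_of_mem_bdry hs.1 (by simp : s ∈ {v | v ∈ p₁ ++ [s]})).symm
  have htouch₂ : G.Touch F {v | v ∈ s' :: p₄} :=
    touch_of_mem_bdry hs'.1 (by simp : s' ∈ {v | v ∈ s' :: p₄})
  have hsD := hFb hs
  have hsD' := hFb hs'
  -- If F met p₁, the route along p₁, through F and on from s' would miss the attachment s. The case
  -- of p₄ is symmetric, with s' missed.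
  have hF₁ : ∀ v ∈ p₁, v ∉ F := by
    intro v hv hvF
    have := h.attach_subset_of_lists hab (List.IsChain.left_of_append hch) hch₂
      (fun v hv => hR₁ v (by simp [hv])) hR₂ hFc hF ⟨v, hv, v, hvF, Or.inl rfl⟩ htouch₂
      (fun x hx => hhead x (by
        rw [List.head?_append_of_ne_nil _ (List.ne_nil_of_mem hv)]; exact hx))
      hlast₂ ⟨hsD, hs.2⟩
    rcases this with (h' | h') | h'
    · exact hnd'.2.2 s h' s (Or.inl rfl) rfl
    · exact hsF h'
    · rcases List.mem_cons.1 h' with h' | h'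
      · exact hne h'
      · exact hnd'.2.1.1.2.2 h'
  have hF₄ : ∀ v ∈ p₄, v ∉ F := by
    intro v hv hvF
    have := h.attach_subset_of_lists hab hch₁ hch₂.tail hR₁
      (fun v hv => hR₂ v (List.mem_cons_of_mem _ hv)) hFc hF htouch₁ ⟨v, hvF, v, hv, Or.inl rfl⟩
      hhead₁ (fun y hy => hlast₂ y (by
        rw [List.getLast?_cons_of_ne_nil (List.ne_nil_of_mem hv)]; exact hy)) ⟨hsD', hs'.2⟩
    rcases this with (h' | h') | h'
    · rcases List.mem_append.1 h' with h' | h'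
      · exact hnd'.2.2 s' h' s' (by simp) rfl
      · exact hne (List.mem_singleton.1 h').symm
    · exact hsF' h'
    · exact hnd'.2.1.2.2.1.1 h'
  -- The route that replaces p₃ by F must still contain all attachments of D, so none lies on p₃.
  have hp₃ : ∀ v ∈ p₃, v ∉ G.bdry F ∩ E := by
    intro v hv hvF
    have := h.attach_subset_of_lists hab hch₁ hch₂ hR₁ hR₂ hFc hF htouch₁ htouch₂ hhead₁ hlast₂
      ⟨hFb hvF, hvF.2⟩
    rcases this with (h' | h') | h'
    · rcases List.mem_append.1 h' with h' | h'
      · exact hnd'.2.2 v h' v (by simp [hv]) rfl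
      · exact hnd'.2.1.1.1 (List.mem_singleton.1 h' ▸ hv)
    · exact hvF.1.1 h'
    · exact hnd'.2.1.2.2.2 v hv v (List.mem_cons.1 h') rfl
  have hQ₁ : ∀ v ∈ p₁ ++ [s], v ∈ E \ F := by
    intro v hv
    refine ⟨(hR₁ v hv).1, ?_⟩
    rcases List.mem_append.1 hv with h' | h'
    · exact hF₁ v h'
    · rw [List.mem_singleton.1 h']; exact hsF
  have hQ₂ : ∀ v ∈ s' :: p₄, v ∈ E \ F := by
    intro v hv
    refine ⟨(hR₂ v hv).1, ?_⟩
    rcases List.mem_cons.1 hv with h' | h'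
    · rw [h']; exact hsF'
    · exact hF₄ v h'
  refine h.ring.ringed_of_append hFE hl (by simp)
    (Q := [{v | v ∈ p₁ ++ [s]}, D ∪ {v | v ∈ s' :: p₄}]) ?_ ?_ ?_ ?_ (by simp) ?_ ?_ ?_ ?_
  · have hc₂ := h.conn_core.union (conn_of_isChain hch₂ (by simp))
      (touch_of_mem_bdry hsD' (by simp : s' ∈ {v | v ∈ s' :: p₄}))
    intro A hA
    rcases List.mem_pair.1 hA with rfl | rfl
    · exact conn_of_isChain hch₁ (by simp)
    · exact hc₂
  · simp only [List.mem_cons, List.not_mem_nil, or_false, forall_eq_or_imp, forall_eq]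
    refine ⟨hQ₁, Set.union_subset ?_ ?_⟩
    · exact fun v hv => ⟨h.subset hv, Set.disjoint_left.1 hDF hv⟩
    · exact fun v hv => hQ₂ v (List.mem_cons.2 hv)
  · rw [List.pairwise_pair, Set.disjoint_left]
    rintro v hv (hvD | hvp)
    · exact (hR₁ v hv).2 hvD
    · rcases List.mem_append.1 hv with hv | hv
      · rcases List.mem_cons.1 hvp with h' | h'
        · exact hnd'.2.2 v hv v (by simp [h']) rfl
        · exact hnd'.2.2 v hv v (by simp [h']) rfl
      · rw [List.mem_singleton] at hv
        subst hv
        rcases List.mem_cons.1 hvp with h' | h'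
        · exact hne h'
        · exact hnd'.2.1.1.2.2 h'
  · rw [List.isChain_pair]
    exact (touch_of_mem_bdry hsD (by simp : s ∈ {v | v ∈ p₁ ++ [s]})).symm.mono subset_rfl
      Set.subset_union_left
  · intro x hx A hA
    obtain rfl : a = x := by
      rw [← List.cons_append, List.getLast?_append_of_ne_nil _ (by simp)] at hx
      simpa using hx
    obtain rfl : {v | v ∈ p₁ ++ [s]} = A := by simpa using hA
    exact ⟨a, h.ring.mem_self a hab.mem, (p₁ ++ [s]).head (by simp), List.head_mem _,
      Or.inr (hhead₁ _ (List.head?_eq_some_head _)).symm⟩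
  · intro A hA y hy
    obtain rfl : b = y := by simpa using hy
    obtain rfl : D ∪ {v | v ∈ s' :: p₄} = A := by simpa using hA
    exact ⟨(s' :: p₄).getLast (by simp), Or.inr (List.getLast_mem _), b,
      h.ring.mem_self b hab.symm.mem, Or.inr (hlast₂ _ (List.getLast?_eq_some_getLast _))⟩
  · simp only [List.mem_cons, List.not_mem_nil, or_false, forall_eq_or_imp, forall_eq]
    constructor
    · refine Set.subsingleton_singleton (a := s).anti ?_
      rintro v ⟨hv, hvF⟩
      rcases List.mem_append.1 hv with h' | h'
      · exact absurd ⟨hvF, (hR₁ v hv).1⟩ (hp₁ v h')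
      · simpa using h'
    · refine Set.subsingleton_singleton (a := s').anti ?_
      rintro v ⟨hv | hv, hvF⟩
      · exact absurd hv (hFb ⟨hvF, h.subset hv⟩).1
      · rcases hv with h' | h'
        · exact h'
        · exact absurd ⟨hvF, (hR₂ v (List.mem_cons_of_mem _ h')).1⟩ (hp₄ v h')
  · intro v hv
    have := hSp' v hv
    simp only [List.mem_append, List.mem_cons] at this
    rcases this with h' | h' | h' | h'
    · exact absurd hv (hp₁ v h')
    · exact ⟨_, by simp, (by simp [h'] : v ∈ {v | v ∈ p₁ ++ [s]})⟩
    · exact absurd hv (hp₃ v h')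
    · exact ⟨D ∪ {v | v ∈ s' :: p₄}, by simp, Or.inr (List.mem_cons.2 h')⟩

end IsMaxCore

/-! ### Counting the ring members unseen by the core -/

/-- The second bound is the one used later; it also carries the induction past a head satisfying P,
as the next entry then fails P. -/
lemma _root_.List.two_mul_countP_le {α : Type*} {P : α → Prop} [DecidablePred P] {l : List α}
    (h : l.IsChain fun a b => ¬ (P a ∧ P b)) (hlast : ∀ y ∈ l.getLast?, ¬ P y) (hl : l ≠ []) :
    2 * l.countP P ≤ l.length ∧ ((∀ x ∈ l.head?, ¬ P x) → 2 * l.countP P + 1 ≤ l.length) := by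
  induction l with
  | nil => exact absurd rfl hl
  | cons a l ih =>
    rcases l with _ | ⟨b, l⟩
    · have : ¬ P a := hlast a (by simp)
      simp [this]
    · rw [List.isChain_cons_cons] at h
      obtain ⟨h1, h2⟩ := ih h.2 (fun y hy => hlast y (by simpa using hy)) (by simp)
      rw [List.countP_cons]
      by_cases ha : P a
      · have hb : ¬ P b := fun hb => h.1 ⟨ha, hb⟩
        have := h2 (by simpa using hb)
        simp only [ha, decide_true, if_true, List.length_cons] at this ⊢
        refine ⟨by omega, fun hh => absurd ha (hh a (by simp))⟩
      · simp only [ha, decide_false, List.length_cons] at h1 ⊢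
        simp only [Bool.false_eq_true, if_false]
        omega

lemma ncard_setOf_mem_and {cs : List V} (hcs : cs.Nodup) (P : V → Prop) [DecidablePred P] :
    {v | v ∈ cs ∧ P v}.ncard = cs.countP P := by
  classical
  rw [List.countP_eq_length_filter, ← List.toFinset_card_of_nodup (hcs.filter _),
    ← Set.ncard_coe_finset]
  congr 1
  ext v; simp

namespace IsMaxCore

variable {E D : Set V} {cs : List V} {B : V → Set V}

/-- Fewer than half of the members of the ring are not seen by `D`. -/
lemma ncard_bdry_diff_le (h : G.IsMaxCore E cs B D) :
    G.bdry E \ G.bdry D = ∅ ∨ 2 * (G.bdry E \ G.bdry D).ncard + 3 ≤ cs.length := by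
  classical
  obtain ⟨a, b, l, hl, ha, hb, hab⟩ := h.exists_consec_path
  have haD := h.mem_bdry_core hab ha hb
  have hbD := h.mem_bdry_core hab.symm hb ha
  have hrest : ∀ v ∈ cs, v ∉ G.bdry D → v ∈ G.bdry (E \ D) := by
    intro v hv hvD
    obtain ⟨hvE, e, he, hadj⟩ := (h.ring.mem_iff v).1 hv
    exact ⟨fun h' => hvE h'.1, e, ⟨he, fun heD => hvD ⟨fun h' => hvE (h.subset h'), e, heD, hadj⟩⟩,
      hadj⟩
  -- A ring member unseen by D has its neighbours in E \ D, so by `mem_bdry_core` no adjacent member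
  -- is seen from E \ D. This excludes two consecutive unseen members, and unseen members next to a
  -- or b.
  have hind : ∀ u v, Consec cs u v → v ∉ G.bdry D → u ∉ G.bdry (E \ D) := fun u v huv hv hu =>
    hv (h.mem_bdry_core huv.symm (hrest v huv.symm.mem hv) hu)
  have hchain := isChain_consec hl
  have hset : G.bdry E \ G.bdry D = {v | v ∈ cs ∧ v ∉ G.bdry D} := by
    ext v; simp [h.ring.mem_iff]
  have hcount : (G.bdry E \ G.bdry D).ncard = l.countP fun v => v ∉ G.bdry D := by
    rw [hset, ncard_setOf_mem_and h.ring.nodup, hl.perm.countP_eq]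
    simp [haD, hbD]
  have hlen : cs.length = l.length + 2 := by rw [hl.perm.length_eq]; simp
  rcases eq_or_ne l [] with rfl | hne
  · left
    rw [← Set.ncard_eq_zero (by rw [hset]; exact (List.finite_toSet cs).subset fun v hv => hv.1),
      hcount]
    simp
  · right
    have hlc : l.IsChain (Consec cs) := (List.IsChain.tail hchain).left_of_append
    have := (List.two_mul_countP_le (l := l) (P := fun v => v ∉ G.bdry D) ?_ ?_ hne).2 ?_
    · rw [hcount, hlen]; omega
    · exact hlc.imp fun u v huv ⟨hu, hv⟩ => hind u v huv hv (hrest u huv.mem hu)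
    · intro y hy hyD
      have := (List.isChain_append.1 (List.IsChain.tail hchain : (l ++ [a]).IsChain _)).2.2 y hy a
        (by simp)
      exact hind a y this.symm hyD ha
    · intro y hy hyD
      have hby : Consec cs b y := by
        rcases l with _ | ⟨y', l⟩
        · exact absurd rfl hne
        obtain rfl : y' = y := by simpa using hy
        exact (List.isChain_cons_cons.1 hchain).1
      exact hind b y hby hyD hb

end IsMaxCore

/-! ### Separators and the recursive decomposition -/

/-- In a graph without a `k`-wheel minor, each connected ringed set is cut into ringed pieces by few
of its vertices. -/
lemma exists_separator [Finite V] {k m : ℕ} (hk : 3 ≤ k) (hkm : k ≤ m)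
    (hm : ∀ j, 2 * j + 6 ≤ 3 * k → j ≤ m) (hG : ¬ (wheelGraph k).IsMinorOf G) {E : Set V}
    (hE : G.Conn E) (hR : G.Ringed E) :
    ∃ Y ⊆ E, Y.Nonempty ∧ (G.bdry E ∪ Y).ncard ≤ m ∧
      ∀ F ⊆ E \ Y, G.Conn F → G.bdry F ⊆ G.bdry E ∪ Y → G.Ringed F := by
  have hlt := hR.ncard_bdry_lt hk hG hE
  obtain ⟨cs, B, h⟩ := id hR
  have hone : ∀ x, (G.bdry E ∪ {x}).ncard ≤ m := by
    intro x
    have := Set.ncard_union_le (G.bdry E) {x}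
    rw [Set.ncard_singleton] at this
    omega
  by_cases hcs : cs.length ≤ 1
  · obtain ⟨x, hx, hF⟩ := exists_separator_of_length_le_one hE h hcs
    exact ⟨{x}, by simpa using hx, Set.singleton_nonempty x, hone x, fun F hFE _ => hF F hFE⟩
  by_cases hav : ∀ x ∈ E, ∃ K ⊆ E \ {x}, G.Conn K ∧ G.bdry E ⊆ G.bdry K
  · obtain ⟨D, hD⟩ := exists_isMaxCore h hE hav (by omega)
    have hlt' := hD.ringed_core.ncard_bdry_lt hk hG hD.conn_core
    refine ⟨G.bdry D ∩ E, Set.inter_subset_right, hD.nonempty_attach, ?_, ?_⟩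
    · have hsub : G.bdry E ∪ G.bdry D ∩ E ⊆ (G.bdry E \ G.bdry D) ∪ G.bdry D := by
        rw [Set.sdiff_union_self]
        exact Set.union_subset_union_right _ Set.inter_subset_left
      have h1 := (Set.ncard_le_ncard hsub).trans (Set.ncard_union_le _ _)
      -- Both boundaries have at most k - 1 vertices, so the sum is at most k - 1 or (k - 4)/2 + (k
      -- - 1).
      rcases hD.ncard_bdry_diff_le with h2 | h2
      · rw [h2, Set.ncard_empty] at h1; omega
      · rw [h.length_eq] at h2
        exact hm _ (by omega)
    · intro F hF hFc hFb
      have hFE : F ⊆ E := hF.trans Set.sdiff_subset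
      have hFS : Disjoint F (G.bdry D) :=
        Set.disjoint_left.2 fun v hv hvD => (hF hv).2 ⟨hvD, hFE hv⟩
      have hFb' : G.bdry F ∩ E ⊆ G.bdry D := by
        rintro v ⟨hv, hvE⟩
        exact ((hFb hv).resolve_left fun h' => h'.1 hvE).1
      -- All attachments of D in E have been removed, so a component meeting D is D itself.
      by_cases hmeet : (F ∩ D).Nonempty
      · have hFD : F ⊆ D := hFc.subset_of_disjoint_bdry hmeet hFS
        have hDF : D ⊆ F := by
          refine hD.conn_core.subset_of_disjoint_bdry (by rwa [Set.inter_comm]) ?_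
          exact Set.disjoint_left.2 fun v hv hvF => (hFb' ⟨hvF, hD.subset hv⟩).1 hv
        rw [hFD.antisymm hDF]
        exact hD.ringed_core
      · exact hD.ringed_rest (fun v hv => ⟨hFE hv, fun hvD => hmeet ⟨v, hv, hvD⟩⟩) hFc hFS hFb'
  · push Not at hav
    obtain ⟨x, hx, hav⟩ := hav
    refine ⟨{x}, by simpa using hx, Set.singleton_nonempty x, hone x, fun F hF hFc hFb => ?_⟩
    -- F avoids x, so by the choice of x it misses some boundary vertex z, which x can replace in
    -- the ring.
    obtain ⟨z, hz, hzF⟩ := Set.not_subset.1 (hav F hF hFc)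
    have hbx : G.bdry F ∩ E ⊆ {x} := by
      rintro v ⟨hv, hvE⟩
      exact (hFb hv).resolve_left fun h' => h'.1 hvE
    refine h.ringed_of_replace (hF.trans Set.sdiff_subset) ?_ (Set.subsingleton_singleton.anti hbx)
      hz hzF
    exact hE.diff (conn_singleton x) (by simpa using ⟨hx, fun hxF => (hF hxF).2 rfl⟩) hbx

/-- Below the root bag bdry E hangs the bag bdry E ∪ Y, and below that the decompositions of the
components of E \ Y. These are smaller than E because Y is nonempty. -/
lemma Ringed.hasDecomp [Finite V] {k m : ℕ} (hk : 3 ≤ k) (hkm : k ≤ m)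
    (hm : ∀ j, 2 * j + 6 ≤ 3 * k → j ≤ m) (hG : ¬ (wheelGraph k).IsMinorOf G) {E : Set V}
    (hE : G.Conn E) (hR : G.Ringed E) : G.HasDecomp m (E ∪ G.bdry E) (G.bdry E) := by
  induction hn : E.ncard using Nat.strong_induction_on generalizing E with
  | _ n ih =>
  subst hn
  obtain ⟨Y, hY, ⟨y, hy⟩, hcard, hF⟩ := exists_separator hk hkm hm hG hE hR
  have hbd : Disjoint (G.bdry E) E := Set.disjoint_left.2 fun v hv => hv.1
  have hX : G.HasDecomp m ((G.bdry E ∪ Y) ∪ (E \ Y)) (G.bdry E ∪ Y) := by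
    refine hasDecomp_union_of_components hcard ?_ ?_ ?_
    · rw [Set.disjoint_left]
      rintro v hv (h' | h')
      · exact h'.1 hv.1
      · exact hv.2 h'
    · rintro v ⟨hv, e, he, hadj⟩
      by_cases hvE : v ∈ E
      · right
        by_contra hvY
        exact hv ⟨hvE, hvY⟩
      · exact Or.inl ⟨hvE, e, he.1, hadj⟩
    · intro F hFE hFc hFb
      refine ih _ ?_ hFc (hF F hFE hFc hFb) rfl
      exact Set.ncard_lt_ncard ⟨hFE.trans Set.sdiff_subset, fun h' => (hFE (h' (hY hy))).2 hy⟩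
  have hS : G.HasDecomp m (G.bdry E) (G.bdry E) :=
    hasDecomp_self ((Set.ncard_le_ncard Set.subset_union_left).trans hcard)
  have := hS.glue hX Set.inter_subset_left (Set.inter_subset_left.trans Set.subset_union_left)
    (fun u hu v _ _ => Or.inl (Or.inl (Or.inl hu)))
  convert this using 1
  ext v
  have : v ∈ Y → v ∈ E := @hY v
  simp only [Set.mem_union, Set.mem_sdiff]
  tauto

/-- In a graph without a `k`-wheel minor, a cyclic sequence of fewer than `k` vertices is the root
bag of a tree-decomposition with small bags. -/
lemma hasDecomp_of_cycle_chain [Finite V] {k m : ℕ} (hk : 3 ≤ k) (hkm : k ≤ m)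
    (hm : ∀ j, 2 * j + 6 ≤ 3 * k → j ≤ m) (hG : ¬ (wheelGraph k).IsMinorOf G) {cs : List V}
    (hnd : cs.Nodup) (hcs : Cycle.Chain (fun a b => a = b ∨ G.Adj a b) (cs : Cycle V))
    (hlen : cs.length ≤ m) : G.HasDecomp m Set.univ {v | v ∈ cs} := by
  classical
  have hcard : {v | v ∈ cs}.ncard ≤ m := by
    have := ncard_setOf_mem_and hnd (fun _ => True)
    simp only [and_true, decide_true, List.countP_true] at this
    rwa [this]
  have := hasDecomp_union_of_components (G := G) (W := {v | v ∈ cs}ᶜ) hcard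
    disjoint_compl_left (fun v hv => by simpa using hv.1) ?_
  · rwa [Set.union_compl_self] at this
  · intro F hF hFc hFb
    refine Ringed.hasDecomp hk hkm hm hG hFc ?_
    refine ringed_of_isNecklace (L := cs.map fun v => {v}) ⟨?_, ?_, ?_, ?_⟩ ?_ ?_
    · intro A hA
      obtain ⟨v, -, rfl⟩ := List.mem_map.1 hA
      exact conn_singleton v
    · intro A hA
      obtain ⟨v, hv, rfl⟩ := List.mem_map.1 hA
      simpa using fun hvF => hF hvF hv
    · rw [List.pairwise_map]
      exact hnd.imp fun hne => by simpa using hne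
    · rw [← Cycle.map_coe, Cycle.chain_map]
      exact hcs.imp fun a b hab => ⟨a, rfl, b, rfl, hab⟩
    · intro A hA
      obtain ⟨v, -, rfl⟩ := List.mem_map.1 hA
      exact Set.subsingleton_singleton.anti Set.inter_subset_left
    · intro v hv
      exact ⟨{v}, List.mem_map_of_mem (hFb hv), rfl⟩

/-! ### Tree-width and complete graphs -/

lemma HasDecomp.exists_rootedTreeDecomposition {m : ℕ} {S : Set V}
    (h : G.HasDecomp m Set.univ S) :
    ∃ D : G.RootedTreeDecomposition, D.IsRootedAt S ∧ ∀ t, (D.bag t).card ≤ m := by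
  obtain ⟨N, _, T, r, bag, hT, hc, hr, -, hadj, hconn⟩ := h
  exact ⟨{ Node := N
           tree := T
           isTree := hT
           bag := bag
           exists_mem_bag := fun v => (hconn v trivial).nonempty
           exists_adj_bag := fun u v => hadj u trivial v trivial
           connected_bags := fun v => hconn v trivial
           root := r }, hr, hc⟩

lemma bddBelow_width : BddBelow {w : ℤ | ∃ D : G.TreeDecomposition, D.width = w} :=
  ⟨-1, by rintro _ ⟨D, rfl⟩; unfold TreeDecomposition.width; omega⟩

lemma HasDecomp.treeWidth_lt {m : ℕ} {S : Set V} (h : G.HasDecomp m Set.univ S) :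
    G.treeWidth < m := by
  obtain ⟨D, -, hD⟩ := h.exists_rootedTreeDecomposition
  have h1 : G.treeWidth ≤ D.toTreeDecomposition.width := csInf_le bddBelow_width ⟨_, rfl⟩
  have h2 : (Finset.univ.sup fun t => (D.bag t).card) ≤ m := Finset.sup_le fun t _ => hD t
  unfold TreeDecomposition.width at h1
  omega

/-- Some bag of a tree-decomposition of a complete graph contains all vertices. -/
lemma TreeDecomposition.exists_forall_mem_bag (D : (⊤ : SimpleGraph V).TreeDecomposition) :
    ∃ t, ∀ v, v ∈ D.bag t := by
  classical
  by_contra hcon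
  push Not at hcon
  choose v hv using hcon
  -- The nodes whose bags contain `v t` form a subtree avoiding t, and s is the neighbour of t in
  -- its direction.
  have key : ∀ t, ∃ s, D.tree.Adj t s ∧ ∀ u, v t ∈ D.bag u →
      (D.tree.deleteEdges {s(t, s)}).Reachable s u := by
    intro t
    have hA : D.tree.Conn {u | v t ∈ D.bag u} := D.connected_bags (v t)
    obtain ⟨w, hw⟩ := hA.nonempty
    have hAt : {u | v t ∈ D.bag u} ⊆ {t}ᶜ := by
      rintro u hu rfl; exact hv u hu
    let C := D.tree.compIn {t}ᶜ w
    have hwC : w ∈ C := self_mem_compIn (hAt hw)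
    have hAC : {u | v t ∈ D.bag u} ⊆ C :=
      hA.subset_of_disjoint_bdry ⟨w, hw, hwC⟩ ((bdry_compIn_disjoint _ _).symm.mono_left hAt)
    have htC : t ∉ C := fun h => compIn_subset _ _ h rfl
    obtain ⟨p⟩ := D.isTree.1.preconnected w t
    obtain ⟨d, -, h1, h2⟩ := p.exists_boundary_dart C hwC htC
    have hdt : d.snd = t := by
      by_contra hne
      exact h2 (mem_compIn_of_adj h1 hne d.adj)
    refine ⟨d.fst, hdt ▸ d.adj.symm, fun u hu => ?_⟩
    have hr := (conn_compIn (G := D.tree) (hAt hw)).preconnected ⟨d.fst, h1⟩ ⟨u, hAC hu⟩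
    let f : D.tree.induce C →g D.tree.deleteEdges {s(t, d.fst)} :=
      ⟨Subtype.val, fun {a b} hab => by
        rw [deleteEdges_adj]
        refine ⟨hab, fun h => ?_⟩
        have : t ∈ s(a.1, b.1) := by rw [h]; simp
        rcases Sym2.mem_iff.1 this with h' | h'
        · exact htC (h' ▸ a.2)
        · exact htC (h' ▸ b.2)⟩
    exact hr.map f
  choose f hf hreach using key
  -- A tree has fewer edges than nodes, so two nodes point at each other along the same edge.
  have hcard := D.isTree.card_edgeFinset
  obtain ⟨t, -, t', -, hne, heq⟩ := Finset.exists_ne_map_eq_of_card_lt_of_maps_to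
    (s := (Finset.univ : Finset D.Node)) (t := D.tree.edgeFinset) (f := fun t => s(t, f t))
    (by rw [Finset.card_univ]; omega) (fun t _ => by simpa using hf t)
  simp only [Sym2.eq_iff, hne, false_and, false_or] at heq
  obtain ⟨h1, h2⟩ := heq
  obtain ⟨u, hu, hu'⟩ : ∃ u, v t ∈ D.bag u ∧ v t' ∈ D.bag u := by
    by_cases hvv : v t = v t'
    · obtain ⟨u, hu⟩ := D.exists_mem_bag (v t)
      exact ⟨u, hu, hvv ▸ hu⟩
    · exact D.exists_adj_bag _ _ hvv
  have hr := hreach t u hu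
  have hr' := hreach t' u hu'
  rw [h2] at hr
  rw [← h1, Sym2.eq_swap] at hr'
  -- A bag containing both missed vertices would connect the ends of that edge without using it.
  refine isAcyclic_iff_forall_adj_isBridge.1 D.isTree.2 (h2 ▸ hf t) (hr'.trans hr.symm)

lemma le_treeWidth_top [Finite V] : (Nat.card V : ℤ) - 1 ≤ (⊤ : SimpleGraph V).treeWidth := by
  classical
  have := Fintype.ofFinite V
  refine le_csInf ?_ ?_
  · refine ⟨_, ⟨{ Node := Unit
                  tree := ⊥
                  isTree := IsTree.of_subsingleton
                  bag := fun _ => Finset.univ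
                  exists_mem_bag := by simp
                  exists_adj_bag := by simp
                  connected_bags := fun v => ?_ }, rfl⟩⟩
    convert conn_singleton (G := (⊥ : SimpleGraph Unit)) ()
    ext; simp
  · rintro _ ⟨D, rfl⟩
    obtain ⟨t, ht⟩ := D.exists_forall_mem_bag
    have h1 : (D.bag t).card ≤ Finset.univ.sup fun t => (D.bag t).card :=
      Finset.le_sup (f := fun t => (D.bag t).card) (Finset.mem_univ t)
    have h2 : D.bag t = Finset.univ := by ext v; simp [ht v]
    rw [h2, Finset.card_univ, ← Nat.card_eq_fintype_card] at h1
    unfold TreeDecomposition.width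
    omega

lemma IsMinorOf.card_le {W : Type*} {H : SimpleGraph W} [Finite V] (h : H.IsMinorOf G) :
    Nat.card W ≤ Nat.card V := by
  obtain ⟨B, hB, hd, -⟩ := h
  have hne : ∀ w, (B w).Nonempty := fun w => Conn.nonempty (hB w)
  choose f hf using hne
  refine Nat.card_le_card_of_injective f fun w w' hww => ?_
  by_contra hne
  exact Set.disjoint_left.1 (hd w w' hne) (hf w) (hww ▸ hf w')

lemma Iso.isMinorOf {W W' : Type*} {H : SimpleGraph W} {H' : SimpleGraph W'} (e : H ≃g H')
    (h : H'.IsMinorOf G) : H.IsMinorOf G := by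
  obtain ⟨B, hB, hd, ha⟩ := h
  exact ⟨fun w => B (e w), fun w => hB _, fun w w' hne => hd _ _ (e.injective.ne hne),
    fun w w' hww => ha _ _ (e.map_rel_iff.2 hww)⟩

/-- The support of a closed walk lists its base twice. Once the first copy is dropped, the first
edge of the walk becomes the closing link of the cyclic sequence. -/
lemma cycle_chain_support_tail {u : V} {p : G.Walk u u} (hp : ¬ p.Nil) :
    Cycle.Chain (fun a b => a = b ∨ G.Adj a b) (p.support.tail : Cycle V) := by
  have hne : p.support.tail ≠ [] := by
    cases p with
    | nil => exact absurd Walk.Nil.nil hp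
    | cons h p => simp
  have hlast : p.support.tail.getLast hne = u := by
    rw [List.getLast_tail, Walk.getLast_support]
  have hsplit : p.support.tail = p.support.tail.dropLast ++ [u] := by
    conv_lhs => rw [← List.dropLast_append_getLast hne, hlast]
  have hrot : p.support.tail ~r u :: p.support.tail.dropLast := by
    conv_lhs => rw [hsplit]
    exact List.isRotated_append
  rw [Cycle.coe_eq_coe.2 hrot, Cycle.chain_coe_cons, ← hsplit]
  have := p.isChain_adj_support
  rw [← Walk.cons_tail_support] at this
  exact this.imp fun _ _ h => Or.inr h

end SimpleGraph

/-! ### Assembly of the two statements -/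

theorem theorem2 :
    (∀ (W : Type v) (H : SimpleGraph W), H.IsWheel →
      (∀ (V : Type u) [Finite V] (G : SimpleGraph V),
        max (3 / 2 * (Nat.card W : ℚ) - 9 / 2) ((Nat.card W : ℚ) - 1) ≤ (G.treeWidth : ℚ) →
          H.IsMinorOf G) ∧
      (∃ f : ℤ, SimpleGraph.IsGridMinorValue.{u, v} H f ∧
        (f : ℚ) ≤ max (3 / 2 * (Nat.card W : ℚ) - 9 / 2) ((Nat.card W : ℚ) - 1) ∧
        (Nat.card W ≤ 7 → f = (Nat.card W : ℤ) - 1))) ∧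
    (∀ (k : ℕ), 3 ≤ k →
      ∀ (V : Type u) [Finite V] (G : SimpleGraph V),
        ¬ (SimpleGraph.wheelGraph k).IsMinorOf G →
        ∀ C : G.Subgraph, (C.IsSingleEdge ∨ (C.IsCycleSubgraph ∧ C.verts.ncard ≤ k - 1)) →
          ∃ D : G.RootedTreeDecomposition, D.IsRootedAt C.verts ∧
            ∀ t : D.Node, ((D.bag t).card : ℚ) ≤ max (3 / 2 * (k : ℚ) - 3) (k : ℚ)) := by
  -- Bag sizes and tree-width are integers, so 3k/2 - 3 may be rounded down.
  have hbound : ∀ k : ℕ, 3 ≤ k →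
      ((max k ((3 * k - 6) / 2) : ℕ) : ℚ) ≤ max (3 / 2 * (k : ℚ) - 3) (k : ℚ) := by
    intro k hk
    rw [Nat.cast_max]
    refine max_le (le_max_right _ _) (le_max_of_le_left ?_)
    have h : 2 * ((3 * k - 6) / 2) + 6 ≤ 3 * k := by omega
    have h' : (2 * ((3 * k - 6) / 2 : ℕ) + 6 : ℚ) ≤ 3 * k := by exact_mod_cast h
    linarith
  have hm : ∀ k j : ℕ, 2 * j + 6 ≤ 3 * k → j ≤ max k ((3 * k - 6) / 2) :=
    fun k j hj => le_max_of_le_right (by omega)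
  constructor
  · rintro W H ⟨k, hk, ⟨e⟩⟩
    have hcard : Nat.card W = k + 1 := by
      rw [Nat.card_congr e.toEquiv]; simp
    have hforce : ∀ (V : Type u) [Finite V] (G : SimpleGraph V),
        ((max k ((3 * k - 6) / 2) : ℕ) : ℤ) ≤ G.treeWidth → H.IsMinorOf G := by
      intro V _ G hG
      refine e.isMinorOf ?_
      by_contra hcon
      -- For a bound on tree-width alone, the empty root bag suffices.
      have := (SimpleGraph.hasDecomp_of_cycle_chain hk (le_max_left k _) (hm k) hcon
        List.nodup_nil (Cycle.Chain.nil _) (by simp)).treeWidth_lt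
      omega
    have hq : max (3 / 2 * (Nat.card W : ℚ) - 9 / 2) ((Nat.card W : ℚ) - 1) =
        max (3 / 2 * (k : ℚ) - 3) (k : ℚ) := by
      rw [hcard]; push_cast; congr 1 <;> ring
    rw [hq]
    refine ⟨fun V _ G hG => hforce V G ?_, ?_⟩
    · have h := (hbound k hk).trans hG
      rw [← Int.cast_natCast (R := ℚ)] at h
      exact Int.cast_le.1 h
    -- The complete graph on k vertices refutes every n < k, since H has k + 1 vertices.
    · have hlow : ∀ n : ℤ, SimpleGraph.TreeWidthForcesMinor.{u, v} H n → (k : ℤ) ≤ n := by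
        intro n hn
        by_contra hcon
        have h1 := SimpleGraph.le_treeWidth_top (V := ULift.{u} (Fin k))
        have h2 := (hn (ULift.{u} (Fin k)) ⊤ (by simp at h1; omega)).card_le
        simp [hcard] at h2
      obtain ⟨f, hf, hmin⟩ := Int.exists_least_of_bdd ⟨(k : ℤ), hlow⟩ ⟨_, hforce⟩
      have hle := hmin _ hforce
      refine ⟨f, ⟨hf, fun n hn => hmin n hn⟩, le_trans ?_ (hbound k hk), ?_⟩
      · rw [← Int.cast_natCast (R := ℚ)]
        exact Int.cast_le.2 hle
      -- Here k ≤ 6, so (3k - 6)/2 ≤ k and the two bounds meet at k.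
      · intro h7
        have := hlow f hf
        omega
  · intro k hk V _ G hG C hC
    obtain ⟨cs, hnd, hchain, hverts, hlen⟩ : ∃ cs : List V, cs.Nodup ∧
        Cycle.Chain (fun a b => a = b ∨ G.Adj a b) (cs : Cycle V) ∧ C.verts = {v | v ∈ cs} ∧
          cs.length ≤ k := by
      rcases hC with ⟨a, b, hab, rfl⟩ | ⟨⟨a, p, hp, rfl⟩, hlen⟩
      -- An edge counts as a cyclic sequence of two vertices.
      · refine ⟨[a, b], by simpa using hab.ne, ?_, by ext; simp, by simp; omega⟩
        rw [Cycle.chain_coe_cons]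
        simp [hab, hab.symm]
      · have hset : p.toSubgraph.verts = {v | v ∈ p.support.tail} := by
          ext v
          rw [SimpleGraph.Walk.mem_verts_toSubgraph, ← SimpleGraph.Walk.cons_tail_support]
          simp only [List.mem_cons, List.tail_cons, Set.mem_ofPred_eq]
          constructor
          · rintro (rfl | h)
            · exact p.end_mem_tail_support hp.not_nil
            · exact h
          · exact Or.inr
        refine ⟨p.support.tail, hp.support_nodup, SimpleGraph.cycle_chain_support_tail hp.not_nil,
          hset, ?_⟩
        have := SimpleGraph.ncard_setOf_mem_and hp.support_nodup (fun _ => True)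
        simp only [and_true, decide_true, List.countP_true] at this
        rw [hset, this] at hlen
        omega
    obtain ⟨D, hD, hDc⟩ := (SimpleGraph.hasDecomp_of_cycle_chain hk (le_max_left k _) (hm k) hG hnd
      hchain (hlen.trans (le_max_left _ _))).exists_rootedTreeDecomposition
    refine ⟨D, hverts ▸ hD, fun t => le_trans ?_ (hbound k hk)⟩
    exact_mod_cast hDc t
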